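/- Let $\mathbb C$ be cut along the nonpositive real axis; all roots and powers are principal (square roots have nonnegative real part, $\sqrt0=0$). Put $$R_J(x,y,z,p)=\tfrac32\int_0^\infty\frac{dt}{\sqrt{t+x}\sqrt{t+y}\sqrt{t+z}\,(t+p)},\qquad R_C(x,y)=\tfrac12\int_0^\infty\frac{dt}{\sqrt{t+x}\,(t+y)}.$$ Let $x,y,z,p\in\mathbb C$ satisfy one of the following: (a) $x,y,z$ have nonnegative real part, at most one of them is $0$, and $\operatorname{Re}p>0$; (b) $p\ne0$, $|\arg p|<\pi$, and $x,y,z$ are real and nonnegative with at most one of them $0$; (c) $p\neq 0$, $|\arg p|<\pi$, two of $x,y,z$ are nonzero complex conjugates with phase less than $\pi$ in magnitude, and the third is real and nonnegative. Let $(x_0,y_0,z_0,p_0)=(x,y,z,p)$, $A_0=(x+y+z+2p)/5$, $\delta=(p-x)(p-y)(p-z)$, and for $m\ge0$ $$\lambda_m=\sqrt{x_m}\sqrt{y_m}+\sqrt{x_m}\sqrt{z_m}+\sqrt{y_m}\sqrt{z_m},$$ $$x_{m+1}=\tfrac{x_m+\lambda_m}4,\quad y_{m+1}=\tfrac{y_m+\lambda_m}4,\quad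 z_{m+1}=\tfrac{z_m+\lambda_m}4,\quad p_{m+1}=\tfrac{p_m+\lambda_m}4,\quad A_{m+1}=\tfrac{A_m+\lambda_m}4,$$ $$d_m=(\sqrt{p_m}+\sqrt{x_m})(\sqrt{p_m}+\sqrt{y_m})(\sqrt{p_m}+\sqrt{z_m}),\qquad e_m=\frac{4^{-3m}\delta}{d_m^2}.$$ Then: 1. For every $m\ge 0$: $p_m\ne0$, $d_m\neq0$, $1+e_m$ is nonzero with $|\arg(1+e_m)|<\pi$, the integrals $R_J(x_m,y_m,z_m,p_m)$ and $R_C(1,1+e_m)$ converge absolutely, and the duplication theorem holds: $$R_J(x_m,y_m,z_m,p_m)=\tfrac14R_J(x_{m+1},y_{m+1},z_{m+1},p_{m+1})+\frac6{d_m}R_C(1,1+e_m).$$ Consequently, for every $n\ge0$, $R_J(x,y,z,p)=4^{-n}R_J(x_n,y_n,z_n,p_n)+6\sum_{m=0}^{n-1}4^{-m}d_m^{-1}R_C(1,1+e_m)$. 2. Let $0<r<10^{-4}$ and $Q=(r/4)^{-1/6}\max\{|A_0-x|,|A_0-y|,|A_0-z|,|A_0-p|\}$. Then $4^{-n}Q<|A_n|$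 for all sufficiently large $n$. For any $n\ge 0$ with $4^{-n}Q<|A_n|$, let $$X=\frac{A_0-x}{4^nA_n},\quad Y=\frac{A_0-y}{4^nA_n},\quad Z=\frac{A_0-z}{4^nA_n},\quad P=\frac{-X-Y-Z}2,$$ $$E_2=XY+XZ+YZ-3P^2,\quad E_3=XYZ+2E_2P+4P^3,\quad E_4=(2XYZ+E_2P+3P^3)P,\quad E_5=XYZP^2,$$ $$S_n=A_n^{-3/2}\Bigl(1-\tfrac3{14}E_2+\tfrac16E_3+\tfrac9{88}E_2^2-\tfrac3{22}E_4-\tfrac9{52}E_2E_3+\tfrac3{26}E_5\Bigr).$$ Say that $v$ approximates $u$ with relative error less than $r$ if $|u-v|<r|v|$. Then $S_n$ approximates $R_J(x_n,y_n,z_n,p_n)$ with relative error less than $r$. Moreover, let $\rho_0,\dots,\rho_{n-1}\in\mathbb C$ be any values approximating $R_C(1,1+e_0),\dots,R_C(1,1+e_{n-1})$ with relative error less than $r$, and let $$\widetilde R=4^{-n}S_n+6\sum_{m=0}^{n-1}\frac{4^{-m}}{d_m}\rho_m .$$ Then, in all cases (a), (b), (c), $$|R_J(x,y,z,p)-\widetilde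 R|<r\Bigl(|4^{-n}S_n|+6\sum_{m=0}^{n-1}\Bigl|\frac{4^{-m}}{d_m}\rho_m\Bigr|\Bigr).$$ If in addition $p$ is real, the $\rho_m$ are real, and $x,y,z$ are as in (b) or (c), then $\widetilde R$ approximates $R_J(x,y,z,p)$ with relative error less than $r$: $|R_J(x,y,z,p)-\widetilde R|<r|\widetilde R|$. -/

import Mathlib

open Set Filter MeasureTheory

namespace Carlson

noncomputable section

/-! ### The integrals -/

/-- Integrand of `R_J` without the factor `3/2`. `Complex.sqrt` is the principal square root (real
part nonnegative), so for arguments in the cut plane this is the branch that is positive for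
positive arguments and varies continuously. -/
def rjIntegrand (x y z p : ℂ) (t : ℝ) : ℂ :=
  (Complex.sqrt (t + x) * Complex.sqrt (t + y) * Complex.sqrt (t + z))⁻¹ * (t + p)⁻¹

/-- The symmetric elliptic integral of the third kind, for `p` in the complex plane cut along the
nonpositive real axis (where no principal value is needed). -/
def RJ (x y z p : ℂ) : ℂ := (3 / 2) * ∫ t in Ioi (0 : ℝ), rjIntegrand x y z p t

/-- Integrand of `R_C` without the factor `1/2`. -/
def rcIntegrand (x y : ℂ) (t : ℝ) : ℂ := (Complex.sqrt (t + x))⁻¹ * (t + y)⁻¹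

/-- The degenerate integral `R_C(x, y) = R_F(x, y, y)`, for `y` in the complex plane cut along the
nonpositive real axis. -/
def RC (x y : ℂ) : ℂ := (1 / 2) * ∫ t in Ioi (0 : ℝ), rcIntegrand x y t

/-! ### Admissible arguments -/

/-- `w` is a nonnegative real number. -/
def IsNonnegReal (w : ℂ) : Prop := w.im = 0 ∧ 0 ≤ w.re

/-- `w` is nonzero with phase less than `π` in magnitude. -/
def InCutPlane (w : ℂ) : Prop := w ≠ 0 ∧ |w.arg| < Real.pi

/-- At most one of the three numbers is zero. -/
def AtMostOneZero (x y z : ℂ) : Prop :=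
  ¬(x = 0 ∧ y = 0) ∧ ¬(x = 0 ∧ z = 0) ∧ ¬(y = 0 ∧ z = 0)

/-- `x, y, z` are real and nonnegative and at most one of them is zero. -/
def RealTriple (x y z : ℂ) : Prop :=
  IsNonnegReal x ∧ IsNonnegReal y ∧ IsNonnegReal z ∧ AtMostOneZero x y z

/-- `a, b` are complex conjugates in the cut plane and `c` is real and nonnegative. -/
def ConjPairAndReal (a b c : ℂ) : Prop :=
  InCutPlane a ∧ InCutPlane b ∧ b = star a ∧ IsNonnegReal c

/-- Two of `x, y, z` are complex conjugates in the cut plane, the third is real and nonnegative. -/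
def ConjTriple (x y z : ℂ) : Prop :=
  ConjPairAndReal x y z ∨ ConjPairAndReal x z y ∨ ConjPairAndReal y z x

/-- The restrictions on the arguments of `R_J`. -/
def Admissible (x y z p : ℂ) : Prop :=
  (0 ≤ x.re ∧ 0 ≤ y.re ∧ 0 ≤ z.re ∧ AtMostOneZero x y z ∧ 0 < p.re) ∨
    (InCutPlane p ∧ (RealTriple x y z ∨ ConjTriple x y z))

/-! ### The iteration -/

/-- The quantities `x_m, y_m, z_m, p_m, A_m` carried along by the iteration. -/
structure State where
  x : ℂ
  y : ℂ
  z : ℂ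
  p : ℂ
  A : ℂ

/-- `λ_m`. -/
def State.lam (s : State) : ℂ :=
  Complex.sqrt s.x * Complex.sqrt s.y + Complex.sqrt s.x * Complex.sqrt s.z
    + Complex.sqrt s.y * Complex.sqrt s.z

/-- One duplication step. -/
def State.next (s : State) : State where
  x := (s.x + s.lam) / 4
  y := (s.y + s.lam) / 4
  z := (s.z + s.lam) / 4
  p := (s.p + s.lam) / 4
  A := (s.A + s.lam) / 4

/-- `A_0`. -/
def A0 (x y z p : ℂ) : ℂ := (x + y + z + 2 * p) / 5

/-- The state after `m` duplication steps. -/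
def iter (x y z p : ℂ) : ℕ → State
  | 0 => { x := x, y := y, z := z, p := p, A := A0 x y z p }
  | m + 1 => (iter x y z p m).next

/-- `δ`. -/
def delta (x y z p : ℂ) : ℂ := (p - x) * (p - y) * (p - z)

/-- `Q`. -/
def Q (r : ℝ) (x y z p : ℂ) : ℝ :=
  (r / 4) ^ (-(1 / 6) : ℝ) *
    max (max ‖A0 x y z p - x‖ ‖A0 x y z p - y‖) (max ‖A0 x y z p - z‖ ‖A0 x y z p - p‖)

/-- `d_m`. -/
def d (x y z p : ℂ) (m : ℕ) : ℂ :=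
  let s := iter x y z p m
  (Complex.sqrt s.p + Complex.sqrt s.x) * (Complex.sqrt s.p + Complex.sqrt s.y)
    * (Complex.sqrt s.p + Complex.sqrt s.z)

/-- `e_m`. -/
def e (x y z p : ℂ) (m : ℕ) : ℂ := delta x y z p / (4 ^ (3 * m) * d x y z p m ^ 2)

/-- The iteration may be stopped at stage `n` for the prescribed relative error `r`. -/
def MayStop (r : ℝ) (x y z p : ℂ) (n : ℕ) : Prop :=
  Q r x y z p / 4 ^ n < ‖(iter x y z p n).A‖

/-! ### The approximation -/

/-- The truncated series, a polynomial in `E₂, E₃, E₄, E₅`. -/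
def truncatedSeries (E₂ E₃ E₄ E₅ : ℂ) : ℂ :=
  1 - 3 / 14 * E₂ + 1 / 6 * E₃ + 9 / 88 * E₂ ^ 2 - 3 / 22 * E₄ - 9 / 52 * (E₂ * E₃)
    + 3 / 26 * E₅

/-- The truncated series as a function of `X, Y, Z`. -/
def seriesXYZ (X Y Z : ℂ) : ℂ :=
  let P := (-X - Y - Z) / 2
  let E₂ := X * Y + X * Z + Y * Z - 3 * P ^ 2
  let E₃ := X * Y * Z + 2 * E₂ * P + 4 * P ^ 3
  let E₄ := (2 * (X * Y * Z) + E₂ * P + 3 * P ^ 3) * P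
  let E₅ := X * Y * Z * P ^ 2
  truncatedSeries E₂ E₃ E₄ E₅

/-- The approximation to `R_J(x_n, y_n, z_n, p_n)`: `A_n ^ (-3/2)` times the truncated series. -/
def seriesApprox (x y z p : ℂ) (n : ℕ) : ℂ :=
  let An := (iter x y z p n).A
  let a := A0 x y z p
  An ^ (-(3 / 2) : ℂ) *
    seriesXYZ ((a - x) / (4 ^ n * An)) ((a - y) / (4 ^ n * An)) ((a - z) / (4 ^ n * An))

/-- The approximation to `R_J(x, y, z, p)` computed with `n` duplications, `ρ m` being the computed
value of `R_C(1, 1 + e_m)`. -/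
def approx (x y z p : ℂ) (ρ : ℕ → ℂ) (n : ℕ) : ℂ :=
  1 / 4 ^ n * seriesApprox x y z p n
    + 6 * ∑ m ∈ Finset.range n, 1 / 4 ^ m / d x y z p m * ρ m

/-- The sum of the moduli of the terms of `approx`. -/
def approxAbs (x y z p : ℂ) (ρ : ℕ → ℂ) (n : ℕ) : ℝ :=
  ‖1 / 4 ^ n * seriesApprox x y z p n‖
    + 6 * ∑ m ∈ Finset.range n, ‖1 / 4 ^ m / d x y z p m * ρ m‖

/-- `v` approximates `u` with relative error less than `r` in magnitude: the true value `u` lies in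
the disc around the computed value `v` with radius `r` times the modulus of `v`. -/
def RelErrLT (r : ℝ) (u v : ℂ) : Prop := ‖u - v‖ < r * ‖v‖

end

end Carlson

open Carlson

/-!
The substitution `u = t + λ(t) - λ(0)`, where `λ(t)` is formed from `x + t, y + t, z + t`, carries
the integrand of `R_J` at the arguments `x + λ, …` into an algebraic function of `t`. It is complex
if the arguments are, so instead of a change of variables the proof of the duplication theorem
compares derivatives. Translate all arguments by `t ≥ 0`. By `hasDerivAt_RJ_translate` and the
differential equation `exists_hasDerivAt_RC` of `w ↦ R_C(1, 1 + w)`, both sides have the derivative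
`-(3 / 2)` times the integrand (`Admissible.hasDerivAt_duplicated`), and the right side vanishes as
`t → ∞` (`tendsto_duplicated_add`); this is `Admissible.RJ_eq_duplicated`. The restrictions on the
arguments are needed for `|e| < 1` (`Admissible.norm_eNum_lt`) and for `p + λ` to stay in the cut
plane; they are preserved by translation and by the duplication step. Since
`x + λ = (√x + √y) (√x + √z)` is a product of two numbers with positive real part, the branches of
the square roots agree.

The iteration terminates because `4 ^ n (A_n - x_n)` is constant, while the same factorization gives
`|x_{n+1}| ≥ min (|x_n|, |y_n|, |z_n|) / 2` in the right half plane, which all of `x_n, y_n, z_n`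
enter after one step (`Admissible.exists_le_norm_iter`).

For the error of the series, `A_n` lies in the right half plane when the iteration stops
(`StopData.re_pos`), and the integrand is `(t + A)^(-5/2)` divided by
`√(1 - w X) √(1 - w Y) √(1 - w Z) (1 - w P)` with `w = A / (t + A)`. Integration of the Taylor
polynomial of degree five in `w` gives the truncated series (`integral_ratio_pow`,
`seriesXYZ_eq`). Let `ε = (r / 4)^(1/6)`, a bound for `|X|, |Y|, |Z|, |P|`. As
`X + Y + Z + 2 P = 0`, the Taylor coefficients are polynomials without linear term in the power
sums, which are at most `5 ε ^ k`. The derivative of the ratio of polynomial and function has no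
terms of order less than five, which bounds the Taylor remainder by `(11 / 4) (|w| ε) ^ 6`
(`norm_inv_rootProd_sub_tpoly_le`). Integrating this against `|w| ^ 8 ≤ (1 + 4 t² / |A|²)⁻¹`, which
includes a factor `|w| ^ 2` from `(t + A)^(-5/2)`, leaves a relative error of at most
`(13 / 4) ε ^ 6 = (13 / 16) r`, while the truncated series differs from `1` by at most `1 / 50`.

In the real cases every term of the approximation is nonnegative (`RealCase.approxAbs_eq`), so that
the sum of the moduli of the terms is the modulus of the sum.
-/

namespace Carlson

open Complex (slitPlane)
open scoped Topology ComplexConjugate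

/-! ### The principal square root -/

theorem inCutPlane_iff {w : ℂ} : InCutPlane w ↔ w ∈ slitPlane := by
  rw [Complex.mem_slitPlane_iff_arg, InCutPlane, and_comm]
  refine and_congr_left fun _ => ?_
  rw [abs_lt]
  exact ⟨fun h => h.2.ne,
    fun h => ⟨Complex.neg_pi_lt_arg w, lt_of_le_of_ne (Complex.arg_le_pi w) h⟩⟩

theorem csqrt_sq (z : ℂ) : Complex.sqrt z ^ 2 = z := by
  rw [Complex.sqrt, ← Complex.cpow_nat_mul]; simp

theorem csqrt_mul_self (z : ℂ) : Complex.sqrt z * Complex.sqrt z = z := by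
  rw [← sq, csqrt_sq]

theorem csqrt_re (z : ℂ) : (Complex.sqrt z).re = √((‖z‖ + z.re) / 2) :=
  Complex.cpow_inv_two_re z

theorem csqrt_re_nonneg (z : ℂ) : 0 ≤ (Complex.sqrt z).re := by
  rw [csqrt_re]; positivity

theorem csqrt_re_pos {z : ℂ} (hz : z ∈ slitPlane) : 0 < (Complex.sqrt z).re := by
  rw [csqrt_re]
  apply Real.sqrt_pos.2
  rcases Complex.mem_slitPlane_iff.1 hz with h | h
  · have := norm_nonneg z; linarith
  · have := Complex.abs_re_lt_norm.2 h
    have := neg_abs_le z.re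
    linarith

theorem csqrt_ne_zero {z : ℂ} (hz : z ∈ slitPlane) : Complex.sqrt z ≠ 0 := fun h => by
  have := csqrt_re_pos hz; simp [h] at this

theorem norm_csqrt (z : ℂ) : ‖Complex.sqrt z‖ = √‖z‖ := by
  rw [eq_comm, Real.sqrt_eq_iff_mul_self_eq (norm_nonneg _) (norm_nonneg _), ← norm_mul,
    csqrt_mul_self]

theorem csqrt_eq_of_sq {w z : ℂ} (h : w ^ 2 = z) (hw : 0 < w.re) : Complex.sqrt z = w := by
  rcases sq_eq_sq_iff_eq_or_eq_neg.1 ((csqrt_sq z).trans h.symm) with h | h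
  · exact h
  · have := csqrt_re_nonneg z
    rw [h] at this; simp at this; linarith

/-- The square root maps the closed right half plane into the sector of half-angle `π / 4`. -/
theorem abs_im_csqrt_le {z : ℂ} (hz : 0 ≤ z.re) :
    |(Complex.sqrt z).im| ≤ (Complex.sqrt z).re := by
  apply abs_le_of_sq_le_sq _ (csqrt_re_nonneg z)
  have := congrArg Complex.re (csqrt_mul_self z)
  rw [Complex.mul_re] at this
  nlinarith

theorem abs_im_csqrt_lt {z : ℂ} (hz : 0 < z.re) :
    |(Complex.sqrt z).im| < (Complex.sqrt z).re := by
  apply abs_lt_of_sq_lt_sq _ (csqrt_re_nonneg z)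
  have := congrArg Complex.re (csqrt_mul_self z)
  rw [Complex.mul_re] at this
  nlinarith

theorem mul_re_pos_of_abs_im_lt {a b : ℂ} (ha : |a.im| < a.re) (hb : |b.im| ≤ b.re)
    (hb' : 0 < b.re) : 0 < (a * b).re := by
  rw [Complex.mul_re]
  have h1 : |a.im * b.im| ≤ |a.im| * b.re := by
    rw [abs_mul]; exact mul_le_mul_of_nonneg_left hb (abs_nonneg _)
  have h2 : |a.im| * b.re < a.re * b.re := mul_lt_mul_of_pos_right ha hb'
  have := le_abs_self (a.im * b.im)
  linarith

theorem mul_re_nonneg_of_abs_im_le {a b : ℂ} (ha : |a.im| ≤ a.re) (hb : |b.im| ≤ b.re) :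
    0 ≤ (a * b).re := by
  rw [Complex.mul_re]
  have h1 : |a.im * b.im| ≤ a.re * b.re := by
    rw [abs_mul]
    exact mul_le_mul ha hb (abs_nonneg _) ((abs_nonneg _).trans ha)
  have := le_abs_self (a.im * b.im)
  linarith

theorem csqrt_mul {a b : ℂ} (ha : 0 < a.re) (hb : 0 < b.re) :
    Complex.sqrt (a * b) = Complex.sqrt a * Complex.sqrt b := by
  apply csqrt_eq_of_sq
  · rw [mul_pow, csqrt_sq, csqrt_sq]
  · exact mul_re_pos_of_abs_im_lt (abs_im_csqrt_lt ha) (abs_im_csqrt_le hb.le)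
      (csqrt_re_pos (Or.inl hb))

theorem csqrt_conj {z : ℂ} (hz : z ∈ slitPlane) :
    Complex.sqrt (conj z) = conj (Complex.sqrt z) := by
  apply csqrt_eq_of_sq
  · rw [← map_pow, csqrt_sq]
  · simpa using csqrt_re_pos hz

theorem csqrt_ofReal {r : ℝ} (hr : 0 ≤ r) : Complex.sqrt (r : ℂ) = (√r : ℝ) := by
  rcases hr.eq_or_lt with rfl | hr
  · simp
  · apply csqrt_eq_of_sq
    · rw [← Complex.ofReal_pow, Real.sq_sqrt hr.le]
    · simpa using hr

theorem hasDerivAt_csqrt {z : ℂ} (hz : z ∈ slitPlane) :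
    HasDerivAt Complex.sqrt ((2 * Complex.sqrt z)⁻¹) z := by
  refine (Complex.hasDerivAt_sqrt hz).congr_deriv ?_
  rw [mul_inv, div_eq_mul_inv, mul_comm]
  congr 1
  rw [Complex.sqrt, ← Complex.cpow_neg]
  norm_num

/-- A number of the cut plane or zero: the values allowed for `x, y, z`. -/
def CutOrZero (w : ℂ) : Prop := w = 0 ∨ w ∈ slitPlane

theorem add_mem_slitPlane {w : ℂ} (hw : CutOrZero w) {t : ℝ} (ht : 0 < t) :
    (t : ℂ) + w ∈ slitPlane := by
  rw [Complex.mem_slitPlane_iff]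
  rcases hw with rfl | h
  · left; simpa using ht
  · rcases Complex.mem_slitPlane_iff.1 h with h | h
    · left; simp; linarith
    · right; simpa using h

theorem add_mem_slitPlane' {w : ℂ} (hw : w ∈ slitPlane) {t : ℝ} (ht : 0 ≤ t) :
    (t : ℂ) + w ∈ slitPlane := by
  rcases ht.eq_or_lt with rfl | ht
  · simpa using hw
  · exact add_mem_slitPlane (Or.inr hw) ht

theorem continuousAt_csqrt {z : ℂ} (hz : CutOrZero z) : ContinuousAt Complex.sqrt z := by
  apply Complex.continuousAt_sqrt
  rcases hz with rfl | h
  · simp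
  · exact (Complex.mem_slitPlane_iff.1 h).imp le_of_lt id

/-! ### Convergence of the integrals -/

/-- On the ray issuing from a point of the cut plane in the positive direction, the modulus is
bounded below by a linear function. -/
theorem exists_mul_le_norm_add {a : ℂ} (ha : a ∈ slitPlane) :
    ∃ c : ℝ, 0 < c ∧ ∀ v : ℝ, 0 ≤ v → c * (1 + v) ≤ ‖(v : ℂ) + a‖ := by
  rcases Complex.mem_slitPlane_iff.1 ha with h | h
  · refine ⟨min 1 a.re, by positivity, fun v hv => ?_⟩
    have h1 : ((v : ℂ) + a).re ≤ ‖(v : ℂ) + a‖ := Complex.re_le_norm _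
    simp only [Complex.add_re, Complex.ofReal_re] at h1
    have h2 := min_le_left 1 a.re
    have h3 := min_le_right 1 a.re
    nlinarith
  · have hi : 0 < |a.im| := abs_pos.2 h
    refine ⟨|a.im| / (1 + |a.im| + ‖a‖), by positivity, fun v hv => ?_⟩
    rw [div_mul_eq_mul_div, div_le_iff₀ (by positivity)]
    have h1 : |((v : ℂ) + a).im| ≤ ‖(v : ℂ) + a‖ := Complex.abs_im_le_norm _
    simp only [Complex.add_im, Complex.ofReal_im, zero_add] at h1
    have h2 : v ≤ ‖(v : ℂ) + a‖ + ‖a‖ := by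
      have := norm_sub_le ((v : ℂ) + a) a
      simpa [abs_of_nonneg hv] using this
    have h3 := norm_nonneg a
    nlinarith

/-- A function that dominates, up to constant factors, all integrands below. -/
noncomputable def majorant (t : ℝ) : ℝ := (√t * (1 + t))⁻¹

theorem majorant_nonneg {t : ℝ} (ht : 0 < t) : 0 ≤ majorant t := by
  unfold majorant; positivity

theorem integrableOn_majorant : IntegrableOn majorant (Ioi 0) := by
  apply integrableOn_Ioi_deriv_of_nonneg (g := fun t => 2 * Real.arctan (√t))
    (l := 2 * (Real.pi / 2))
  · fun_prop
  · intro t ht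
    have ht : 0 < t := ht
    refine (((Real.hasDerivAt_sqrt ht.ne').arctan).const_mul 2).congr_deriv ?_
    rw [Real.sq_sqrt ht.le, majorant]
    have := Real.sqrt_pos.2 ht
    field_simp
  · exact fun t ht => majorant_nonneg ht
  · refine Tendsto.const_mul _ ?_
    exact (tendsto_nhds_of_tendsto_nhdsWithin Real.tendsto_arctan_atTop).comp
      Real.tendsto_sqrt_atTop

theorem integrableOn_of_le_majorant {f : ℝ → ℂ} {C : ℝ} (hf : ContinuousOn f (Ioi 0))
    (h : ∀ t > 0, ‖f t‖ ≤ C * majorant t) : IntegrableOn f (Ioi 0) :=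
  (integrableOn_majorant.const_mul C).mono' (hf.aestronglyMeasurable measurableSet_Ioi)
    ((ae_restrict_iff' measurableSet_Ioi).2 (Eventually.of_forall h))

theorem norm_integral_le_of_le_majorant {f : ℝ → ℂ} {C : ℝ}
    (h : ∀ t > 0, ‖f t‖ ≤ C * majorant t) :
    ‖∫ t in Ioi (0 : ℝ), f t‖ ≤ C * ∫ t in Ioi (0 : ℝ), majorant t := by
  rw [← integral_const_mul]
  exact norm_integral_le_of_norm_le (integrableOn_majorant.const_mul C)
    ((ae_restrict_iff' measurableSet_Ioi).2 (Eventually.of_forall h))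

theorem norm_rjIntegrand (x y z p : ℂ) (t : ℝ) : ‖rjIntegrand x y z p t‖ =
    (√‖t + x‖ * √‖t + y‖ * √‖t + z‖)⁻¹ * ‖t + p‖⁻¹ := by
  simp [rjIntegrand, norm_csqrt]

/-- If all four moduli are at least `c (1 + t)`, except for one that need only be at least `c t`,
then the integrand is dominated by the majorant. -/
theorem norm_rjIntegrand_le {x y z p : ℂ} {c t : ℝ} (hc : 0 < c) (ht : 0 < t)
    (hx : c * t ≤ ‖t + x‖) (hy : c * (1 + t) ≤ ‖t + y‖) (hz : c * (1 + t) ≤ ‖t + z‖)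
    (hp : c * (1 + t) ≤ ‖t + p‖) : ‖rjIntegrand x y z p t‖ ≤ (√c ^ 5)⁻¹ * majorant t := by
  rw [norm_rjIntegrand, majorant, ← mul_inv, ← mul_inv]
  have hc' := Real.sqrt_pos.2 hc
  have ht' := Real.sqrt_pos.2 ht
  apply inv_anti₀ (by positivity)
  have h1 : √c * √t ≤ √‖t + x‖ := by rw [← Real.sqrt_mul hc.le]; exact Real.sqrt_le_sqrt hx
  have h2 : √c ≤ √‖t + y‖ := Real.sqrt_le_sqrt (by nlinarith)
  have h3 : √c ≤ √‖t + z‖ := Real.sqrt_le_sqrt (by nlinarith)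
  calc √c ^ 5 * (√t * (1 + t)) = √c * √t * √c * √c * (√c ^ 2 * (1 + t)) := by ring
    _ ≤ √‖t + x‖ * √‖t + y‖ * √‖t + z‖ * ‖t + p‖ := by
        rw [Real.sq_sqrt hc.le]; gcongr

theorem continuousOn_rjIntegrand {x y z p : ℂ} (hx : CutOrZero x) (hy : CutOrZero y)
    (hz : CutOrZero z) (hp : p ∈ slitPlane) : ContinuousOn (rjIntegrand x y z p) (Ioi 0) := by
  have key : ∀ w : ℂ, CutOrZero w → ∀ t : ℝ, 0 < t →
      ContinuousAt (fun t : ℝ => Complex.sqrt (t + w)) t := fun w hw t ht =>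
    (hasDerivAt_csqrt (add_mem_slitPlane hw ht)).continuousAt.comp
      (f := fun t : ℝ => (t : ℂ) + w) (by fun_prop)
  intro t ht
  apply ContinuousAt.continuousWithinAt
  apply ContinuousAt.mul
  · apply ContinuousAt.inv₀ (((key x hx t ht).mul (key y hy t ht)).mul (key z hz t ht))
    exact mul_ne_zero (mul_ne_zero (csqrt_ne_zero (add_mem_slitPlane hx ht))
      (csqrt_ne_zero (add_mem_slitPlane hy ht))) (csqrt_ne_zero (add_mem_slitPlane hz ht))
  · apply ContinuousAt.inv₀ (by fun_prop)
    exact Complex.slitPlane_ne_zero (add_mem_slitPlane (Or.inr hp) ht)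

theorem integrableOn_rjIntegrand_aux {x y z p : ℂ} (hx : CutOrZero x) (hy : y ∈ slitPlane)
    (hz : z ∈ slitPlane) (hp : p ∈ slitPlane) :
    IntegrableOn (rjIntegrand x y z p) (Ioi 0) := by
  obtain ⟨a, ha, hxa⟩ : ∃ a : ℝ, 0 < a ∧ ∀ t : ℝ, 0 ≤ t → a * t ≤ ‖(t : ℂ) + x‖ := by
    rcases hx with rfl | hx
    · exact ⟨1, one_pos, fun t ht => by simp [abs_of_nonneg ht]⟩
    · obtain ⟨a, ha, h⟩ := exists_mul_le_norm_add hx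
      exact ⟨a, ha, fun t ht => le_trans (by nlinarith) (h t ht)⟩
  obtain ⟨b, hb, hyb⟩ := exists_mul_le_norm_add hy
  obtain ⟨c, hc, hzc⟩ := exists_mul_le_norm_add hz
  obtain ⟨k, hk, hpk⟩ := exists_mul_le_norm_add hp
  set m := min (min a b) (min c k) with hm
  have h1 : m ≤ a := (min_le_left _ _).trans (min_le_left _ _)
  have h2 : m ≤ b := (min_le_left _ _).trans (min_le_right _ _)
  have h3 : m ≤ c := (min_le_right _ _).trans (min_le_left _ _)
  have h4 : m ≤ k := (min_le_right _ _).trans (min_le_right _ _)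
  apply integrableOn_of_le_majorant (C := (√m ^ 5)⁻¹)
    (continuousOn_rjIntegrand hx (Or.inr hy) (Or.inr hz) hp)
  intro t ht
  apply norm_rjIntegrand_le (by positivity) ht
  · exact le_trans (by gcongr) (hxa t ht.le)
  · exact le_trans (by gcongr) (hyb t ht.le)
  · exact le_trans (by gcongr) (hzc t ht.le)
  · exact le_trans (by gcongr) (hpk t ht.le)

theorem rjIntegrand_swap_xy (x y z p : ℂ) : rjIntegrand x y z p = rjIntegrand y x z p := by
  funext t; simp only [rjIntegrand]; ring

theorem rjIntegrand_swap_xz (x y z p : ℂ) : rjIntegrand x y z p = rjIntegrand z y x p := by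
  funext t; simp only [rjIntegrand]; ring

theorem CutOrZero.mem_of_ne {w : ℂ} (h : CutOrZero w) (h0 : w ≠ 0) : w ∈ slitPlane :=
  h.resolve_left h0

theorem integrableOn_rjIntegrand {x y z p : ℂ} (hx : CutOrZero x) (hy : CutOrZero y)
    (hz : CutOrZero z) (h : AtMostOneZero x y z) (hp : p ∈ slitPlane) :
    IntegrableOn (rjIntegrand x y z p) (Ioi 0) := by
  obtain ⟨h1, h2, h3⟩ := h
  rcases eq_or_ne y 0 with rfl | hy0
  · rw [rjIntegrand_swap_xy]
    exact integrableOn_rjIntegrand_aux hy (hx.mem_of_ne fun h => h1 ⟨h, rfl⟩)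
      (hz.mem_of_ne fun h => h3 ⟨rfl, h⟩) hp
  rcases eq_or_ne z 0 with rfl | hz0
  · rw [rjIntegrand_swap_xz]
    exact integrableOn_rjIntegrand_aux hz (hy.mem_of_ne hy0) (hx.mem_of_ne fun h => h2 ⟨h, rfl⟩) hp
  exact integrableOn_rjIntegrand_aux hx (hy.mem_of_ne hy0) (hz.mem_of_ne hz0) hp

/-- The integral tends to zero as its arguments tend to infinity in the right half plane. -/
theorem norm_RJ_le {x y z p : ℂ} {M : ℝ} (hM : 1 ≤ M) (hx : M ≤ x.re) (hy : M ≤ y.re)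
    (hz : M ≤ z.re) (hp : M ≤ p.re) :
    ‖RJ x y z p‖ ≤ 3 / 2 * (∫ t in Ioi (0 : ℝ), majorant t) / M := by
  have key : ∀ w : ℂ, M ≤ w.re → ∀ t : ℝ, M + t ≤ ‖t + w‖ := fun w hw t => by
    refine le_trans ?_ (Complex.re_le_norm _)
    simp; linarith
  have h : ∀ t > 0, ‖rjIntegrand x y z p t‖ ≤ M⁻¹ * majorant t := fun t ht => by
    rw [norm_rjIntegrand, majorant, ← mul_inv, ← mul_inv]
    have ht' := Real.sqrt_pos.2 ht
    apply inv_anti₀ (by positivity)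
    have h1 : √t ≤ √‖t + x‖ := Real.sqrt_le_sqrt (by linarith [key x hx t])
    have h2 : √M ≤ √‖t + y‖ := Real.sqrt_le_sqrt (by linarith [key y hy t])
    have h3 : √M ≤ √‖t + z‖ := Real.sqrt_le_sqrt (by linarith [key z hz t])
    have h4 : 1 + t ≤ ‖t + p‖ := by linarith [key p hp t]
    calc M * (√t * (1 + t)) = √t * √M * √M * (1 + t) := by
          rw [mul_assoc √t, Real.mul_self_sqrt (by linarith)]; ring
      _ ≤ _ := by gcongr
  have := norm_integral_le_of_le_majorant h
  rw [RJ, norm_mul]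
  calc ‖(3 / 2 : ℂ)‖ * _ ≤ 3 / 2 * (M⁻¹ * ∫ t in Ioi (0 : ℝ), majorant t) := by
        gcongr; norm_num
    _ = _ := by ring

theorem csqrt_add_one {t : ℝ} (ht : 0 ≤ t) : Complex.sqrt (t + 1) = (√(1 + t) : ℝ) := by
  rw [← csqrt_ofReal (by linarith)]; congr 1; push_cast; ring

theorem continuousOn_rcIntegrand {y : ℂ} (hy : y ∈ slitPlane) :
    ContinuousOn (rcIntegrand 1 y) (Ioi 0) := by
  intro t ht
  apply ContinuousAt.continuousWithinAt
  have h1 := add_mem_slitPlane (w := 1) (Or.inr (by simp)) ht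
  apply ContinuousAt.mul
  · refine ContinuousAt.inv₀ ?_ (csqrt_ne_zero h1)
    exact (hasDerivAt_csqrt h1).continuousAt.comp (f := fun t : ℝ => (t : ℂ) + 1) (by fun_prop)
  · apply ContinuousAt.inv₀ (by fun_prop)
    exact Complex.slitPlane_ne_zero (add_mem_slitPlane (Or.inr hy) ht)

theorem norm_rcIntegrand_le {y : ℂ} {c t : ℝ} (hc : 0 < c) (ht : 0 < t)
    (hy : c * (1 + t) ≤ ‖t + y‖) : ‖rcIntegrand 1 y t‖ ≤ c⁻¹ * majorant t := by
  rw [rcIntegrand, norm_mul, norm_inv, norm_inv, csqrt_add_one ht.le, majorant, ← mul_inv,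
    ← mul_inv, Complex.norm_of_nonneg (Real.sqrt_nonneg _)]
  have ht' := Real.sqrt_pos.2 ht
  apply inv_anti₀ (by positivity)
  have : √t ≤ √(1 + t) := Real.sqrt_le_sqrt (by linarith)
  calc c * (√t * (1 + t)) = √t * (c * (1 + t)) := by ring
    _ ≤ _ := by gcongr

theorem integrableOn_rcIntegrand {y : ℂ} (hy : y ∈ slitPlane) :
    IntegrableOn (rcIntegrand 1 y) (Ioi 0) := by
  obtain ⟨c, hc, h⟩ := exists_mul_le_norm_add hy
  exact integrableOn_of_le_majorant (continuousOn_rcIntegrand hy)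
    fun t ht => norm_rcIntegrand_le hc ht (h t ht.le)

theorem RC_re_nonneg {y : ℂ} (hy : 0 < y.re) : 0 ≤ (RC 1 y).re := by
  have h1 : (RC 1 y).re = 1 / 2 * ∫ t in Ioi (0 : ℝ), (rcIntegrand 1 y t).re := by
    have h2 : (1 / 2 : ℂ) = ((1 / 2 : ℝ) : ℂ) := by norm_num
    rw [RC, h2, Complex.re_ofReal_mul]
    congr 1
    exact (integral_re (integrableOn_rcIntegrand (Or.inl hy))).symm
  rw [h1]
  apply mul_nonneg (by norm_num)
  apply setIntegral_nonneg measurableSet_Ioi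
  intro t ht
  have ht : 0 < t := ht
  rw [rcIntegrand, csqrt_add_one ht.le, ← Complex.ofReal_inv, Complex.re_ofReal_mul,
    Complex.inv_re]
  have : 0 ≤ ((t : ℂ) + y).re := by simp; linarith
  have := Complex.normSq_nonneg ((t : ℂ) + y)
  positivity

/-! ### Differentiation of the integrals -/

/-- The product that is integrated in `R_J`, as a function of complex arguments. -/
noncomputable def rjKernel (x y z p : ℂ) : ℂ :=
  (Complex.sqrt x * Complex.sqrt y * Complex.sqrt z)⁻¹ * p⁻¹

theorem rjIntegrand_eq_rjKernel (x y z p : ℂ) (t : ℝ) :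
    rjIntegrand x y z p t = rjKernel (t + x) (t + y) (t + z) (t + p) := rfl

/-- The derivative of `rjKernel` along a common translation of its arguments. -/
noncomputable def rjKernelDeriv (x y z p : ℂ) : ℂ :=
  -rjKernel x y z p * ((2 * x)⁻¹ + (2 * y)⁻¹ + (2 * z)⁻¹ + p⁻¹)

theorem hasDerivAt_rjKernel {x y z p : ℂ} {u : ℂ} (hx : u + x ∈ slitPlane)
    (hy : u + y ∈ slitPlane) (hz : u + z ∈ slitPlane) (hp : u + p ≠ 0) :
    HasDerivAt (fun u => rjKernel (u + x) (u + y) (u + z) (u + p))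
      (rjKernelDeriv (u + x) (u + y) (u + z) (u + p)) u := by
  have key : ∀ w : ℂ, u + w ∈ slitPlane → HasDerivAt (fun u => Complex.sqrt (u + w))
      ((2 * Complex.sqrt (u + w))⁻¹) u := fun w hw => by
    exact ((hasDerivAt_csqrt hw).comp u ((hasDerivAt_id u).add_const w)).congr_deriv (mul_one _)
  have h1 := csqrt_ne_zero hx
  have h2 := csqrt_ne_zero hy
  have h3 := csqrt_ne_zero hz
  have h := (((key x hx).mul (key y hy)).mul (key z hz)).inv (mul_ne_zero (mul_ne_zero h1 h2) h3)
  refine (h.mul (((hasDerivAt_id u).add_const p).inv hp)).congr_deriv ?_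
  have e1 := csqrt_sq (u + x)
  have e2 := csqrt_sq (u + y)
  have e3 := csqrt_sq (u + z)
  simp only [rjKernelDeriv, rjKernel, Pi.mul_apply, Pi.inv_apply, id]
  rw [show (2 * (u + x))⁻¹ = (2 * Complex.sqrt (u + x) ^ 2)⁻¹ by rw [e1],
    show (2 * (u + y))⁻¹ = (2 * Complex.sqrt (u + y) ^ 2)⁻¹ by rw [e2],
    show (2 * (u + z))⁻¹ = (2 * Complex.sqrt (u + z) ^ 2)⁻¹ by rw [e3]]
  field_simp
  ring

theorem norm_rjKernelDeriv_le {x y z p : ℂ} {k : ℝ} (hk : 0 < k) (hx : k ≤ ‖x‖) (hy : k ≤ ‖y‖)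
    (hz : k ≤ ‖z‖) (hp : k ≤ ‖p‖) :
    ‖rjKernelDeriv x y z p‖ ≤ ‖rjKernel x y z p‖ * (5 / 2 * k⁻¹) := by
  have key : ∀ w : ℂ, k ≤ ‖w‖ → ‖(2 * w)⁻¹‖ ≤ 2⁻¹ * k⁻¹ := fun w hw => by
    rw [norm_inv, norm_mul, mul_inv, Complex.norm_ofNat]; gcongr
  have hp' : ‖p⁻¹‖ ≤ k⁻¹ := by rw [norm_inv]; gcongr
  rw [rjKernelDeriv, norm_mul, norm_neg]
  gcongr
  have := norm_add₄_le (a := (2 * x)⁻¹) (b := (2 * y)⁻¹) (c := (2 * z)⁻¹) (d := p⁻¹)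
  linarith [key x hx, key y hy, key z hz]

/-- The derivative of `R_J` along a common translation of its arguments is the negative of the
integrand at `t = 0`. -/
theorem hasDerivAt_RJ_translate {x y z p : ℂ} (hx : x ∈ slitPlane) (hy : y ∈ slitPlane)
    (hz : z ∈ slitPlane) (hp : p ∈ slitPlane) :
    HasDerivAt (fun s => RJ (x + s) (y + s) (z + s) (p + s)) (-(3 / 2) * rjKernel x y z p) 0 := by
  obtain ⟨c, hc, hxc, hyc, hzc, hpc⟩ : ∃ c : ℝ, 0 < c ∧
      (∀ v : ℝ, 0 ≤ v → c * (1 + v) ≤ ‖(v : ℂ) + x‖) ∧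
      (∀ v : ℝ, 0 ≤ v → c * (1 + v) ≤ ‖(v : ℂ) + y‖) ∧
      (∀ v : ℝ, 0 ≤ v → c * (1 + v) ≤ ‖(v : ℂ) + z‖) ∧
      (∀ v : ℝ, 0 ≤ v → c * (1 + v) ≤ ‖(v : ℂ) + p‖) := by
    obtain ⟨c₁, h₁, k₁⟩ := exists_mul_le_norm_add hx
    obtain ⟨c₂, h₂, k₂⟩ := exists_mul_le_norm_add hy
    obtain ⟨c₃, h₃, k₃⟩ := exists_mul_le_norm_add hz
    obtain ⟨c₄, h₄, k₄⟩ := exists_mul_le_norm_add hp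
    refine ⟨min (min c₁ c₂) (min c₃ c₄), by positivity, fun v hv => ?_, fun v hv => ?_,
      fun v hv => ?_, fun v hv => ?_⟩
    · exact le_trans (by gcongr; exact (min_le_left _ _).trans (min_le_left _ _)) (k₁ v hv)
    · exact le_trans (by gcongr; exact (min_le_left _ _).trans (min_le_right _ _)) (k₂ v hv)
    · exact le_trans (by gcongr; exact (min_le_right _ _).trans (min_le_left _ _)) (k₃ v hv)
    · exact le_trans (by gcongr; exact (min_le_right _ _).trans (min_le_right _ _)) (k₄ v hv)
  set F : ℂ → ℝ → ℂ := fun s v => rjIntegrand (x + s) (y + s) (z + s) (p + s) v with hF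
  set F' : ℂ → ℝ → ℂ := fun s v =>
    rjKernelDeriv (s + (v + x)) (s + (v + y)) (s + (v + z)) (s + (v + p)) with hF'
  have hFF : ∀ s v, F s v =
      rjKernel (s + (v + x)) (s + (v + y)) (s + (v + z)) (s + (v + p)) := fun s v => by
    simp only [hF, rjIntegrand_eq_rjKernel]
    congr 1 <;> ring
  -- a translation by less than `c / 2` keeps the arguments away from zero, and in the cut plane
  have far : ∀ w : ℂ, (∀ v : ℝ, 0 ≤ v → c * (1 + v) ≤ ‖(v : ℂ) + w‖) →
      ∀ s ∈ Metric.ball (0 : ℂ) (c / 2), ∀ v : ℝ, 0 < v → c / 2 * (1 + v) ≤ ‖s + (v + w)‖ :=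
      fun w hw s hs v hv => by
    have h1 := hw v hv.le
    have h2 : ‖s‖ < c / 2 := by simpa using hs
    have h3 := norm_sub_le (s + (v + w)) s
    rw [add_sub_cancel_left] at h3
    nlinarith
  obtain ⟨δ, hδ, hball⟩ : ∃ δ > 0, ∀ s ∈ Metric.ball (0 : ℂ) δ, x + s ∈ slitPlane ∧
      y + s ∈ slitPlane ∧ z + s ∈ slitPlane ∧ p + s ∈ slitPlane := by
    have key : ∀ w ∈ slitPlane, ∀ᶠ s in 𝓝 (0 : ℂ), w + s ∈ slitPlane := fun w hw => by
      have : ContinuousAt (fun s : ℂ => w + s) 0 := by fun_prop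
      exact this.eventually_mem (by simpa using Complex.isOpen_slitPlane.mem_nhds hw)
    have := (key x hx).and ((key y hy).and ((key z hz).and (key p hp)))
    exact Metric.eventually_nhds_iff_ball.1 this
  set S := Metric.ball (0 : ℂ) (min (c / 2) δ) with hS
  have hS0 : S ∈ 𝓝 (0 : ℂ) := Metric.ball_mem_nhds _ (by positivity)
  have hSc : S ⊆ Metric.ball 0 (c / 2) := Metric.ball_subset_ball (min_le_left _ _)
  have hSδ : S ⊆ Metric.ball 0 δ := Metric.ball_subset_ball (min_le_right _ _)
  have slit : ∀ w s : ℂ, w + s ∈ slitPlane → ∀ v : ℝ, 0 < v → s + (v + w) ∈ slitPlane :=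
      fun w s h v hv => by
    have := add_mem_slitPlane (Or.inr h) hv
    rwa [show s + ((v : ℂ) + w) = v + (w + s) by ring]
  have hder : ∀ s ∈ S, ∀ v : ℝ, 0 < v → HasDerivAt (fun s => F s v) (F' s v) s :=
      fun s hs v hv => by
    obtain ⟨h1, h2, h3, h4⟩ := hball s (hSδ hs)
    simp only [hFF]
    exact hasDerivAt_rjKernel (slit _ _ h1 v hv) (slit _ _ h2 v hv) (slit _ _ h3 v hv)
      (Complex.slitPlane_ne_zero (slit _ _ h4 v hv))
  have hFbd : ∀ s ∈ S, ∀ v : ℝ, 0 < v → ‖F s v‖ ≤ (√(c / 2) ^ 5)⁻¹ * majorant v :=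
      fun s hs v hv => by
    have r : ∀ w : ℂ, ((v : ℂ) + (w + s)) = s + (v + w) := fun w => by ring
    apply norm_rjIntegrand_le (by positivity) hv <;> rw [r]
    · exact le_trans (by nlinarith) (far x hxc s (hSc hs) v hv)
    · exact far y hyc s (hSc hs) v hv
    · exact far z hzc s (hSc hs) v hv
    · exact far p hpc s (hSc hs) v hv
  have hF'bd : ∀ s ∈ S, ∀ v : ℝ, 0 < v →
      ‖F' s v‖ ≤ (√(c / 2) ^ 5)⁻¹ * (5 / 2 * (c / 2)⁻¹) * majorant v := fun s hs v hv => by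
    have key : ∀ w : ℂ, (∀ v : ℝ, 0 ≤ v → c * (1 + v) ≤ ‖(v : ℂ) + w‖) → c / 2 ≤ ‖s + (v + w)‖ :=
      fun w hw => le_trans (by nlinarith) (far w hw s (hSc hs) v hv)
    have h1 := norm_rjKernelDeriv_le (by positivity) (key x hxc) (key y hyc) (key z hzc) (key p hpc)
    have h2 := hFbd s hs v hv
    rw [hFF] at h2
    refine h1.trans ((mul_le_mul_of_nonneg_right h2 (by positivity)).trans (le_of_eq ?_))
    ring
  have hcont : ∀ s ∈ S, ContinuousOn (F s) (Ioi 0) := fun s hs => by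
    obtain ⟨h1, h2, h3, h4⟩ := hball s (hSδ hs)
    exact continuousOn_rjIntegrand (Or.inr h1) (Or.inr h2) (Or.inr h3) h4
  have hv' : ∀ w ∈ slitPlane, ∀ v : ℝ, 0 ≤ v → (v : ℂ) + w ∈ slitPlane := fun w hw v hv =>
    add_mem_slitPlane' hw hv
  -- translating all arguments is the same as translating the variable of integration
  have hv : ∀ v : ℝ, 0 ≤ v → HasDerivAt (F 0) (F' 0 v) v := fun v hv => by
    have h := (hasDerivAt_rjKernel (hv' x hx v hv) (hv' y hy v hv) (hv' z hz v hv)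
      (Complex.slitPlane_ne_zero (hv' p hp v hv))).comp_ofReal
    have e : F 0 = fun v : ℝ => rjKernel (v + x) (v + y) (v + z) (v + p) := by
      funext v; simp only [hFF, zero_add]
    rw [e]
    simpa only [hF', zero_add] using h
  have hF'cont : ContinuousOn (F' 0) (Ioi 0) := by
    have h1 := hcont 0 (mem_of_mem_nhds hS0)
    have e : F' 0 = fun v : ℝ => -F 0 v *
        ((2 * (v + x))⁻¹ + (2 * (v + y))⁻¹ + (2 * (v + z))⁻¹ + (v + p)⁻¹) := by
      funext v; simp only [hF', hFF, rjKernelDeriv, zero_add]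
    rw [e]
    have ne : ∀ w ∈ slitPlane, ∀ v ∈ Ioi (0 : ℝ), (v : ℂ) + w ≠ 0 := fun w hw v hv =>
      Complex.slitPlane_ne_zero (add_mem_slitPlane (Or.inr hw) hv)
    have ne2 : ∀ w ∈ slitPlane, ∀ v ∈ Ioi (0 : ℝ), 2 * ((v : ℂ) + w) ≠ 0 := fun w hw v hv =>
      mul_ne_zero two_ne_zero (ne w hw v hv)
    refine h1.neg.mul (((ContinuousOn.add ?_ ?_).add ?_).add ?_)
    · exact ContinuousOn.inv₀ (by fun_prop) (ne2 x hx)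
    · exact ContinuousOn.inv₀ (by fun_prop) (ne2 y hy)
    · exact ContinuousOn.inv₀ (by fun_prop) (ne2 z hz)
    · exact ContinuousOn.inv₀ (by fun_prop) (ne p hp)
  have main := hasDerivAt_integral_of_dominated_loc_of_deriv_le (μ := volume.restrict (Ioi 0))
    (F := F) (F' := F') (x₀ := 0) (s := S) hS0
    (Filter.mem_of_superset hS0 fun s hs => (hcont s hs).aestronglyMeasurable measurableSet_Ioi)
    (integrableOn_of_le_majorant (hcont 0 (mem_of_mem_nhds hS0))
      (hFbd 0 (mem_of_mem_nhds hS0)))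
    (hF'cont.aestronglyMeasurable measurableSet_Ioi)
    ((ae_restrict_iff' measurableSet_Ioi).2 (Eventually.of_forall fun v hv s hs =>
      hF'bd s hs v hv))
    (integrableOn_majorant.const_mul _)
    ((ae_restrict_iff' measurableSet_Ioi).2 (Eventually.of_forall fun v hv s hs =>
      hder s hs v hv))
  have hmaj : Tendsto majorant atTop (𝓝 0) := by
    have h1 : Tendsto (fun t : ℝ => √t * (1 + t)) atTop atTop :=
      Real.tendsto_sqrt_atTop.atTop_mul_atTop₀ (tendsto_atTop_add_const_left _ _ tendsto_id)
    exact h1.inv_tendsto_atTop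
  have hlim : Tendsto (F 0) atTop (𝓝 0) := by
    have h0 := hmaj.const_mul ((√(c / 2) ^ 5)⁻¹)
    rw [mul_zero] at h0
    apply squeeze_zero_norm' _ h0
    filter_upwards [eventually_gt_atTop 0] with v hv using hFbd 0 (mem_of_mem_nhds hS0) v hv
  have hint := integral_Ioi_of_hasDerivAt_of_tendsto' (fun v hv' => hv v hv') main.1 hlim
  have h2 := main.2.const_mul (3 / 2)
  rw [hint] at h2
  refine h2.congr_deriv ?_
  simp only [hFF]
  simp

/-- The differential equation satisfied by `w ↦ R_C(1, 1 + w)`, which is `arctan √w / √w`. -/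
theorem exists_hasDerivAt_RC {w : ℂ} (hw : 1 + w ∈ slitPlane) :
    ∃ D : ℂ, HasDerivAt (fun w => RC 1 (1 + w)) D w ∧ RC 1 (1 + w) + 2 * w * D = (1 + w)⁻¹ := by
  obtain ⟨c, hc, hb⟩ := exists_mul_le_norm_add hw
  set F : ℂ → ℝ → ℂ := fun s v => rcIntegrand 1 (1 + s) v with hF
  set F' : ℂ → ℝ → ℂ := fun s v => -((Complex.sqrt (v + 1))⁻¹ * ((v + (1 + s)) ^ 2)⁻¹) with hF'
  obtain ⟨δ, hδ, hball⟩ : ∃ δ > 0, ∀ s ∈ Metric.ball w δ, 1 + s ∈ slitPlane := by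
    have : ContinuousAt (fun s : ℂ => 1 + s) w := by fun_prop
    exact Metric.eventually_nhds_iff_ball.1
      (this.eventually_mem (Complex.isOpen_slitPlane.mem_nhds hw))
  set S := Metric.ball w (min (c / 2) δ) with hS
  have hS0 : S ∈ 𝓝 w := Metric.ball_mem_nhds _ (by positivity)
  have hwS := mem_of_mem_nhds hS0
  have hSδ : S ⊆ Metric.ball w δ := Metric.ball_subset_ball (min_le_right _ _)
  have far : ∀ s ∈ S, ∀ v : ℝ, 0 < v → c / 2 * (1 + v) ≤ ‖(v : ℂ) + (1 + s)‖ := fun s hs v hv => by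
    have h1 := hb v hv.le
    have h2 : ‖s - w‖ < c / 2 := by
      simpa [dist_eq_norm] using Metric.ball_subset_ball (min_le_left _ _) hs
    have h3 := norm_sub_le ((v : ℂ) + (1 + s)) (s - w)
    rw [show (v : ℂ) + (1 + s) - (s - w) = v + (1 + w) by ring] at h3
    nlinarith
  have hder : ∀ s ∈ S, ∀ v : ℝ, 0 < v → HasDerivAt (fun s => F s v) (F' s v) s :=
      fun s hs v hv => by
    have h0 : (v : ℂ) + (1 + s) ≠ 0 :=
      Complex.slitPlane_ne_zero (add_mem_slitPlane (Or.inr (hball s (hSδ hs))) hv)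
    have h1 := (((hasDerivAt_id s).const_add 1).const_add (v : ℂ)).inv h0
    refine (h1.const_mul ((Complex.sqrt (v + 1))⁻¹)).congr_deriv ?_
    simp only [hF', id]
    ring
  have hF'bd : ∀ s ∈ S, ∀ v : ℝ, 0 < v → ‖F' s v‖ ≤ (c / 2)⁻¹ * (c / 2)⁻¹ * majorant v :=
    fun s hs v hv => by
    have h1 := norm_rcIntegrand_le (by positivity) hv (far s hs v hv)
    have h2 : ‖F' s v‖ = ‖rcIntegrand 1 (1 + s) v‖ * ‖(v : ℂ) + (1 + s)‖⁻¹ := by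
      simp only [hF', rcIntegrand, norm_neg, norm_mul, norm_inv, norm_pow]; ring
    have h3 : ‖(v : ℂ) + (1 + s)‖⁻¹ ≤ (c / 2)⁻¹ := by
      apply inv_anti₀ (by positivity)
      exact le_trans (by nlinarith) (far s hs v hv)
    rw [h2]
    refine (mul_le_mul h1 h3 (by positivity) ?_).trans (le_of_eq (by ring))
    exact (norm_nonneg _).trans h1
  have hF'cont : ContinuousOn (F' w) (Ioi 0) := by
    have e : F' w = fun v : ℝ => -(F w v * (v + (1 + w))⁻¹) := by
      funext v; simp only [hF', hF, rcIntegrand, sq, mul_inv]; ring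
    rw [e]
    refine ((continuousOn_rcIntegrand hw).mul (ContinuousOn.inv₀ (by fun_prop) ?_)).neg
    exact fun v hv => Complex.slitPlane_ne_zero (add_mem_slitPlane (Or.inr hw) hv)
  have main := hasDerivAt_integral_of_dominated_loc_of_deriv_le (μ := volume.restrict (Ioi 0))
    (F := F) (F' := F') (x₀ := w) (s := S) hS0
    (Filter.mem_of_superset hS0 fun s hs =>
      (continuousOn_rcIntegrand (hball s (hSδ hs))).aestronglyMeasurable measurableSet_Ioi)
    (integrableOn_rcIntegrand hw)
    (hF'cont.aestronglyMeasurable measurableSet_Ioi)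
    ((ae_restrict_iff' measurableSet_Ioi).2 (Eventually.of_forall fun v hv s hs =>
      hF'bd s hs v hv))
    (integrableOn_majorant.const_mul _)
    ((ae_restrict_iff' measurableSet_Ioi).2 (Eventually.of_forall fun v hv s hs =>
      hder s hs v hv))
  refine ⟨1 / 2 * ∫ v in Ioi (0 : ℝ), F' w v, main.2.const_mul (1 / 2), ?_⟩
  -- the left side of the equation integrates to an algebraic function
  set G : ℝ → ℂ := fun v => -(Complex.sqrt (v + 1) * (v + (1 + w))⁻¹) with hG
  have hGd : ∀ v ∈ Ici (0 : ℝ), HasDerivAt G (1 / 2 * F w v + w * F' w v) v := fun v hv => by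
    have hv : 0 ≤ v := hv
    have h1 : (v : ℂ) + 1 ∈ slitPlane := add_mem_slitPlane' (by simp) hv
    have h2 : (v : ℂ) + (1 + w) ≠ 0 := Complex.slitPlane_ne_zero (add_mem_slitPlane' hw hv)
    have h3 := (hasDerivAt_csqrt h1).comp (v : ℂ) ((hasDerivAt_id (v : ℂ)).add_const 1)
    have h4 := ((hasDerivAt_id (v : ℂ)).add_const (1 + w)).inv h2
    have h5 := (h3.mul h4).neg.comp_ofReal
    refine h5.congr_deriv ?_
    have h6 := csqrt_ne_zero h1
    simp only [hF, hF', rcIntegrand, Function.comp_apply, id, Pi.inv_apply]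
    have h7 : w = (v + (1 + w)) - (Complex.sqrt (v + 1)) ^ 2 := by rw [csqrt_sq]; ring
    generalize Complex.sqrt (v + 1) = a at *
    generalize (v : ℂ) + (1 + w) = b at *
    rw [h7]
    field_simp
    ring
  have hi1 : IntegrableOn (fun v => 1 / 2 * F w v) (Ioi 0) :=
    (integrableOn_rcIntegrand hw).const_mul _
  have hi2 : IntegrableOn (fun v => w * F' w v) (Ioi 0) := main.1.const_mul w
  have hGlim : Tendsto G atTop (𝓝 0) := by
    have h0 : Tendsto (fun v : ℝ => c⁻¹ * (√(1 + v))⁻¹) atTop (𝓝 0) := by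
      have : Tendsto (fun v : ℝ => √(1 + v)) atTop atTop :=
        Real.tendsto_sqrt_atTop.comp (tendsto_atTop_add_const_left _ _ tendsto_id)
      simpa using this.inv_tendsto_atTop.const_mul c⁻¹
    apply squeeze_zero_norm' _ h0
    filter_upwards [eventually_ge_atTop 0] with v hv
    simp only [hG, norm_neg, norm_mul, norm_inv]
    rw [csqrt_add_one hv, Complex.norm_of_nonneg (Real.sqrt_nonneg _)]
    have h1 := hb v hv
    have h2 : 0 < √(1 + v) := Real.sqrt_pos.2 (by linarith)
    have h3 : √(1 + v) ^ 2 = 1 + v := Real.sq_sqrt (by linarith)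
    calc √(1 + v) * ‖(v : ℂ) + (1 + w)‖⁻¹ ≤ √(1 + v) * (c * (1 + v))⁻¹ := by gcongr
      _ = √(1 + v) * (c * √(1 + v) ^ 2)⁻¹ := by rw [h3]
      _ = c⁻¹ * (√(1 + v))⁻¹ := by field_simp
  have hint := integral_Ioi_of_hasDerivAt_of_tendsto' hGd (hi1.add hi2) hGlim
  rw [integral_add hi1 hi2, integral_const_mul, integral_const_mul] at hint
  have hG0 : 0 - G 0 = (1 + w)⁻¹ := by simp [hG]
  rw [hG0] at hint
  rw [← hint, RC]
  ring

/-! ### Admissible arguments and one duplication step -/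

/-- `λ` as a function of `x, y, z`. -/
noncomputable def lam (x y z : ℂ) : ℂ :=
  Complex.sqrt x * Complex.sqrt y + Complex.sqrt x * Complex.sqrt z
    + Complex.sqrt y * Complex.sqrt z

/-- `d` as a function of `x, y, z, p`. -/
noncomputable def dProd (x y z p : ℂ) : ℂ :=
  (Complex.sqrt p + Complex.sqrt x) * (Complex.sqrt p + Complex.sqrt y)
    * (Complex.sqrt p + Complex.sqrt z)

theorem add_lam_x (x y z : ℂ) : x + lam x y z =
    (Complex.sqrt x + Complex.sqrt y) * (Complex.sqrt x + Complex.sqrt z) := by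
  have := csqrt_mul_self x
  rw [lam]; linear_combination -this

theorem add_lam_y (x y z : ℂ) : y + lam x y z =
    (Complex.sqrt x + Complex.sqrt y) * (Complex.sqrt y + Complex.sqrt z) := by
  have := csqrt_mul_self y
  rw [lam]; linear_combination -this

theorem add_lam_z (x y z : ℂ) : z + lam x y z =
    (Complex.sqrt x + Complex.sqrt z) * (Complex.sqrt y + Complex.sqrt z) := by
  have := csqrt_mul_self z
  rw [lam]; linear_combination -this

theorem CutOrZero.csqrt_add_re_pos {x y : ℂ} (hx : CutOrZero x) (hy : CutOrZero y)
    (h : ¬(x = 0 ∧ y = 0)) : 0 < (Complex.sqrt x + Complex.sqrt y).re := by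
  rw [Complex.add_re]
  rcases hx with rfl | hx
  · have := csqrt_re_pos (hy.mem_of_ne fun h' => h ⟨rfl, h'⟩)
    simpa using this
  · have := csqrt_re_pos hx
    have := csqrt_re_nonneg y
    linarith

theorem sq_mem_slitPlane {w : ℂ} (hw : 0 < w.re) : w ^ 2 ∈ slitPlane := by
  rw [Complex.mem_slitPlane_iff, sq, Complex.mul_re, Complex.mul_im]
  by_cases h : w.im = 0
  · left; rw [h]; nlinarith
  · right
    have := mul_ne_zero hw.ne' h
    intro h'; apply this; linarith

theorem mul_mem_slitPlane {a b : ℂ} (ha : 0 < a.re) (hb : 0 < b.re) : a * b ∈ slitPlane := by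
  have := sq_mem_slitPlane (w := Complex.sqrt a * Complex.sqrt b)
    (mul_re_pos_of_abs_im_lt (abs_im_csqrt_lt ha) (abs_im_csqrt_le hb.le)
      (csqrt_re_pos (Or.inl hb)))
  rwa [mul_pow, csqrt_sq, csqrt_sq] at this

theorem div_four_mem_slitPlane {w : ℂ} (hw : w ∈ slitPlane) : w / 4 ∈ slitPlane := by
  have e : w / 4 = ((1 / 4 : ℝ) : ℂ) * w := by push_cast; ring
  rw [Complex.mem_slitPlane_iff, e, Complex.re_ofReal_mul, Complex.im_ofReal_mul]
  rcases Complex.mem_slitPlane_iff.1 hw with h | h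
  · left; positivity
  · right; exact mul_ne_zero (by norm_num) h

/-- `x, y, z` lie in the cut plane, except that one of them may be zero. -/
structure CutTriple (x y z : ℂ) : Prop where
  left : CutOrZero x
  mid : CutOrZero y
  right : CutOrZero z
  ne : AtMostOneZero x y z

namespace CutTriple

variable {x y z : ℂ}

theorem re_xy (h : CutTriple x y z) : 0 < (Complex.sqrt x + Complex.sqrt y).re :=
  h.left.csqrt_add_re_pos h.mid h.ne.1

theorem re_xz (h : CutTriple x y z) : 0 < (Complex.sqrt x + Complex.sqrt z).re :=
  h.left.csqrt_add_re_pos h.right h.ne.2.1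

theorem re_yz (h : CutTriple x y z) : 0 < (Complex.sqrt y + Complex.sqrt z).re :=
  h.mid.csqrt_add_re_pos h.right h.ne.2.2

theorem x_add_lam_mem (h : CutTriple x y z) : x + lam x y z ∈ slitPlane := by
  rw [add_lam_x]; exact mul_mem_slitPlane h.re_xy h.re_xz

theorem y_add_lam_mem (h : CutTriple x y z) : y + lam x y z ∈ slitPlane := by
  rw [add_lam_y]; exact mul_mem_slitPlane h.re_xy h.re_yz

theorem z_add_lam_mem (h : CutTriple x y z) : z + lam x y z ∈ slitPlane := by
  rw [add_lam_z]; exact mul_mem_slitPlane h.re_xz h.re_yz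

end CutTriple

theorem csqrt_div_four {a b : ℂ} (ha : 0 < a.re) (hb : 0 < b.re) :
    Complex.sqrt (a * b / 4) = Complex.sqrt a * Complex.sqrt b / 2 := by
  apply csqrt_eq_of_sq
  · rw [div_pow, mul_pow, csqrt_sq, csqrt_sq]; norm_num
  · have := mul_re_pos_of_abs_im_lt (abs_im_csqrt_lt ha) (abs_im_csqrt_le hb.le)
      (csqrt_re_pos (Or.inl hb))
    rw [show (2 : ℂ) = ((2 : ℝ) : ℂ) by norm_num, Complex.div_ofReal_re]
    positivity

/-- The factorization of `x + λ` makes the product of the three square roots after a duplication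
step rational in the square roots before it. -/
theorem CutTriple.csqrt_prod_next {x y z : ℂ} (h : CutTriple x y z) :
    Complex.sqrt ((x + lam x y z) / 4) * Complex.sqrt ((y + lam x y z) / 4)
      * Complex.sqrt ((z + lam x y z) / 4) =
    (Complex.sqrt x + Complex.sqrt y) * (Complex.sqrt x + Complex.sqrt z)
      * (Complex.sqrt y + Complex.sqrt z) / 8 := by
  rw [add_lam_x, add_lam_y, add_lam_z, csqrt_div_four h.re_xy h.re_xz,
    csqrt_div_four h.re_xy h.re_yz, csqrt_div_four h.re_xz h.re_yz]
  have h1 := csqrt_mul_self (Complex.sqrt x + Complex.sqrt y)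
  have h2 := csqrt_mul_self (Complex.sqrt x + Complex.sqrt z)
  have h3 := csqrt_mul_self (Complex.sqrt y + Complex.sqrt z)
  generalize Complex.sqrt (Complex.sqrt x + Complex.sqrt y) = a at *
  generalize Complex.sqrt (Complex.sqrt x + Complex.sqrt z) = b at *
  generalize Complex.sqrt (Complex.sqrt y + Complex.sqrt z) = c at *
  rw [← h1, ← h2, ← h3]
  ring

theorem IsNonnegReal.cutOrZero {w : ℂ} (h : IsNonnegReal w) : CutOrZero w := by
  rcases h.2.eq_or_lt with h0 | h0
  · left; exact Complex.ext h0.symm h.1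
  · right; exact Or.inl h0

theorem cutOrZero_of_re_nonneg {w : ℂ} (h : 0 ≤ w.re) : CutOrZero w := by
  by_cases hw : w = 0
  · exact Or.inl hw
  right
  rw [Complex.mem_slitPlane_iff]
  rcases h.eq_or_lt with h0 | h0
  · right; intro h1; exact hw (Complex.ext h0.symm h1)
  · exact Or.inl h0

theorem InCutPlane.mem {w : ℂ} (h : InCutPlane w) : w ∈ slitPlane := inCutPlane_iff.1 h

theorem AtMostOneZero.perm_xzy {x y z : ℂ} (h : AtMostOneZero x z y) : AtMostOneZero x y z :=
  ⟨h.2.1, h.1, fun k => h.2.2 k.symm⟩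

theorem AtMostOneZero.perm_yzx {x y z : ℂ} (h : AtMostOneZero y z x) : AtMostOneZero x y z :=
  ⟨fun k => h.2.1 k.symm, fun k => h.2.2 k.symm, h.1⟩

theorem ConjPairAndReal.cutTriple {a b c : ℂ} (h : ConjPairAndReal a b c) : CutTriple a b c := by
  obtain ⟨ha, hb, -, hc⟩ := h
  exact ⟨Or.inr ha.mem, Or.inr hb.mem, hc.cutOrZero, fun k => ha.1 k.1, fun k => ha.1 k.1,
    fun k => hb.1 k.1⟩

theorem RealTriple.cutTriple {x y z : ℂ} (h : RealTriple x y z) : CutTriple x y z :=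
  ⟨h.1.cutOrZero, h.2.1.cutOrZero, h.2.2.1.cutOrZero, h.2.2.2⟩

theorem ConjTriple.cutTriple {x y z : ℂ} (h : ConjTriple x y z) : CutTriple x y z := by
  rcases h with h | h | h
  · exact h.cutTriple
  · have := h.cutTriple
    exact ⟨this.left, this.right, this.mid, this.ne.perm_xzy⟩
  · have := h.cutTriple
    exact ⟨this.right, this.left, this.mid, this.ne.perm_yzx⟩

theorem Admissible.cutTriple {x y z p : ℂ} (h : Admissible x y z p) : CutTriple x y z := by
  rcases h with ⟨hx, hy, hz, h, -⟩ | ⟨-, h | h⟩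
  · exact ⟨cutOrZero_of_re_nonneg hx, cutOrZero_of_re_nonneg hy, cutOrZero_of_re_nonneg hz, h⟩
  · exact h.cutTriple
  · exact h.cutTriple

theorem Admissible.p_mem {x y z p : ℂ} (h : Admissible x y z p) : p ∈ slitPlane := by
  rcases h with ⟨-, -, -, -, hp⟩ | ⟨hp, -⟩
  · exact Or.inl hp
  · exact hp.mem

theorem atMostOneZero_of_ne {x y z : ℂ} (hx : x ≠ 0) (hy : y ≠ 0) : AtMostOneZero x y z :=
  ⟨fun k => hx k.1, fun k => hx k.1, fun k => hy k.1⟩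

theorem IsNonnegReal.add {a b : ℂ} (ha : IsNonnegReal a) (hb : IsNonnegReal b) :
    IsNonnegReal (a + b) :=
  ⟨by simp [ha.1, hb.1], by simpa using add_nonneg ha.2 hb.2⟩

theorem IsNonnegReal.div_four {a : ℂ} (ha : IsNonnegReal a) : IsNonnegReal (a / 4) := by
  rw [show (4 : ℂ) = ((4 : ℝ) : ℂ) by norm_num, IsNonnegReal, Complex.div_ofReal_re,
    Complex.div_ofReal_im]
  exact ⟨by simp [ha.1], div_nonneg ha.2 (by norm_num)⟩

theorem IsNonnegReal.eq_ofReal {a : ℂ} (ha : IsNonnegReal a) : a = (a.re : ℝ) :=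
  Complex.ext rfl (by simpa using ha.1)

theorem isNonnegReal_ofReal {r : ℝ} (hr : 0 ≤ r) : IsNonnegReal (r : ℂ) := ⟨by simp, by simpa⟩

theorem IsNonnegReal.csqrt {a : ℂ} (ha : IsNonnegReal a) : IsNonnegReal (Complex.sqrt a) := by
  rw [ha.eq_ofReal, csqrt_ofReal ha.2]
  exact isNonnegReal_ofReal (Real.sqrt_nonneg _)

theorem IsNonnegReal.mul {a b : ℂ} (ha : IsNonnegReal a) (hb : IsNonnegReal b) :
    IsNonnegReal (a * b) := by
  rw [ha.eq_ofReal, hb.eq_ofReal, ← Complex.ofReal_mul]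
  exact isNonnegReal_ofReal (mul_nonneg ha.2 hb.2)

theorem IsNonnegReal.add_mem {r w : ℂ} (hr : IsNonnegReal r) (hw : w ∈ slitPlane) :
    w + r ∈ slitPlane := by
  rw [hr.eq_ofReal, add_comm]
  exact add_mem_slitPlane' hw hr.2

theorem lam_swap_yz (x y z : ℂ) : lam x z y = lam x y z := by simp only [lam]; ring

theorem lam_rotate (x y z : ℂ) : lam y z x = lam x y z := by simp only [lam]; ring

theorem RealTriple.lam {x y z : ℂ} (h : RealTriple x y z) : IsNonnegReal (lam x y z) := by
  obtain ⟨hx, hy, hz, -⟩ := h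
  exact ((hx.csqrt.mul hy.csqrt).add (hx.csqrt.mul hz.csqrt)).add (hy.csqrt.mul hz.csqrt)

theorem ConjPairAndReal.csqrt_eq {a b c : ℂ} (h : ConjPairAndReal a b c) :
    Complex.sqrt b = conj (Complex.sqrt a) := by
  rw [h.2.2.1]; exact csqrt_conj h.1.mem

theorem isNonnegReal_mul_conj (w : ℂ) : IsNonnegReal (w * conj w) := by
  rw [Complex.mul_conj]; exact isNonnegReal_ofReal (Complex.normSq_nonneg _)

theorem isNonnegReal_add_conj {w : ℂ} (hw : 0 ≤ w.re) : IsNonnegReal (w + conj w) := by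
  rw [Complex.add_conj]; exact isNonnegReal_ofReal (by positivity)

theorem ConjPairAndReal.lam {a b c : ℂ} (h : ConjPairAndReal a b c) :
    IsNonnegReal (lam a b c) := by
  have e : Carlson.lam a b c = Complex.sqrt a * conj (Complex.sqrt a)
      + Complex.sqrt c * (Complex.sqrt a + conj (Complex.sqrt a)) := by
    rw [Carlson.lam, h.csqrt_eq]; ring
  rw [e]
  exact (isNonnegReal_mul_conj _).add
    (h.2.2.2.csqrt.mul (isNonnegReal_add_conj (csqrt_re_nonneg a)))

theorem ConjTriple.lam {x y z : ℂ} (h : ConjTriple x y z) : IsNonnegReal (lam x y z) := by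
  rcases h with h | h | h
  · exact h.lam
  · rw [← lam_swap_yz]; exact h.lam
  · rw [← lam_rotate]; exact h.lam

theorem ConjPairAndReal.add_real {a b c r : ℂ} (h : ConjPairAndReal a b c) (hr : IsNonnegReal r) :
    ConjPairAndReal (a + r) (b + r) (c + r) := by
  obtain ⟨ha, hb, hab, hc⟩ := h
  refine ⟨inCutPlane_iff.2 (hr.add_mem ha.mem), inCutPlane_iff.2 (hr.add_mem hb.mem), ?_, hc.add hr⟩
  have : star r = r := Complex.conj_eq_iff_im.2 hr.1
  rw [hab, star_add, this]

theorem ConjPairAndReal.div_four {a b c : ℂ} (h : ConjPairAndReal a b c) :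
    ConjPairAndReal (a / 4) (b / 4) (c / 4) := by
  obtain ⟨ha, hb, hab, hc⟩ := h
  refine ⟨inCutPlane_iff.2 (div_four_mem_slitPlane ha.mem),
    inCutPlane_iff.2 (div_four_mem_slitPlane hb.mem), ?_, hc.div_four⟩
  rw [hab, star_div₀, star_ofNat]

theorem ConjTriple.add_real {x y z r : ℂ} (h : ConjTriple x y z) (hr : IsNonnegReal r) :
    ConjTriple (x + r) (y + r) (z + r) :=
  h.imp (fun h => h.add_real hr) (Or.imp (fun h => h.add_real hr) fun h => h.add_real hr)

theorem ConjTriple.div_four {x y z : ℂ} (h : ConjTriple x y z) :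
    ConjTriple (x / 4) (y / 4) (z / 4) :=
  h.imp (fun h => h.div_four) (Or.imp (fun h => h.div_four) fun h => h.div_four)

/-- Square roots of numbers in the right half plane lie in the sector of half-angle `π / 4`, so that
their products lie in the right half plane. -/
theorem lam_re_nonneg {x y z : ℂ} (hx : 0 ≤ x.re) (hy : 0 ≤ y.re) (hz : 0 ≤ z.re) :
    0 ≤ (lam x y z).re := by
  rw [lam, Complex.add_re, Complex.add_re]
  have h1 := mul_re_nonneg_of_abs_im_le (abs_im_csqrt_le hx) (abs_im_csqrt_le hy)
  have h2 := mul_re_nonneg_of_abs_im_le (abs_im_csqrt_le hx) (abs_im_csqrt_le hz)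
  have h3 := mul_re_nonneg_of_abs_im_le (abs_im_csqrt_le hy) (abs_im_csqrt_le hz)
  linarith

theorem Admissible.p_add_lam_mem {x y z p : ℂ} (h : Admissible x y z p) :
    p + lam x y z ∈ slitPlane := by
  rcases h with ⟨hx, hy, hz, -, hp⟩ | ⟨hp, h | h⟩
  · left
    have := lam_re_nonneg hx hy hz
    simp only [Complex.add_re]
    linarith
  · exact h.lam.add_mem hp.mem
  · exact h.lam.add_mem hp.mem

theorem Admissible.real_or_conj_next {x y z : ℂ} (h : RealTriple x y z ∨ ConjTriple x y z) :
    RealTriple ((x + lam x y z) / 4) ((y + lam x y z) / 4) ((z + lam x y z) / 4) ∨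
    ConjTriple ((x + lam x y z) / 4) ((y + lam x y z) / 4) ((z + lam x y z) / 4) := by
  rcases h with h | h
  · left
    have hc := h.cutTriple
    refine ⟨(h.1.add h.lam).div_four, (h.2.1.add h.lam).div_four, (h.2.2.1.add h.lam).div_four, ?_⟩
    exact atMostOneZero_of_ne
      (Complex.slitPlane_ne_zero (div_four_mem_slitPlane hc.x_add_lam_mem))
      (Complex.slitPlane_ne_zero (div_four_mem_slitPlane hc.y_add_lam_mem))
  · right
    exact (h.add_real h.lam).div_four

theorem div_four_re (w : ℂ) : (w / 4).re = w.re / 4 := by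
  rw [show (4 : ℂ) = ((4 : ℝ) : ℂ) by norm_num, Complex.div_ofReal_re]

theorem Admissible.next {x y z p : ℂ} (h : Admissible x y z p) :
    Admissible ((x + lam x y z) / 4) ((y + lam x y z) / 4) ((z + lam x y z) / 4)
      ((p + lam x y z) / 4) := by
  have hc := h.cutTriple
  have hp' := h.p_add_lam_mem
  rcases h with ⟨hx, hy, hz, -, hp⟩ | ⟨hp, h⟩
  · left
    have := lam_re_nonneg hx hy hz
    simp only [div_four_re, Complex.add_re]
    refine ⟨by linarith, by linarith, by linarith, ?_, by linarith⟩
    exact atMostOneZero_of_ne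
      (Complex.slitPlane_ne_zero (div_four_mem_slitPlane hc.x_add_lam_mem))
      (Complex.slitPlane_ne_zero (div_four_mem_slitPlane hc.y_add_lam_mem))
  · right
    exact ⟨inCutPlane_iff.2 (div_four_mem_slitPlane hp'), Admissible.real_or_conj_next h⟩

theorem Admissible.translate {x y z p : ℂ} (h : Admissible x y z p) {t : ℝ} (ht : 0 ≤ t) :
    Admissible (x + t) (y + t) (z + t) (p + t) := by
  rcases ht.eq_or_lt with rfl | ht
  · simpa using h
  have hr : IsNonnegReal (t : ℂ) := isNonnegReal_ofReal ht.le
  have hc := h.cutTriple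
  have ne : ∀ w : ℂ, CutOrZero w → w + t ≠ 0 := fun w hw => by
    rw [add_comm]; exact Complex.slitPlane_ne_zero (add_mem_slitPlane hw ht)
  have hne := atMostOneZero_of_ne (z := z + t) (ne x hc.left) (ne y hc.mid)
  rcases h with ⟨hx, hy, hz, -, hp⟩ | ⟨hp, h | h⟩
  · left
    simp only [Complex.add_re, Complex.ofReal_re]
    exact ⟨by linarith, by linarith, by linarith, hne, by linarith⟩
  · right
    exact ⟨inCutPlane_iff.2 (hr.add_mem hp.mem),
      Or.inl ⟨h.1.add hr, h.2.1.add hr, h.2.2.1.add hr, hne⟩⟩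
  · right
    exact ⟨inCutPlane_iff.2 (hr.add_mem hp.mem), Or.inr (h.add_real hr)⟩

theorem ConjPairAndReal.next_re_nonneg {a b c : ℂ} (h : ConjPairAndReal a b c) :
    0 ≤ (a + Carlson.lam a b c).re ∧ 0 ≤ (b + Carlson.lam a b c).re ∧
      0 ≤ (c + Carlson.lam a b c).re := by
  have h1 : Complex.sqrt a + Complex.sqrt b = ((2 * (Complex.sqrt a).re : ℝ) : ℂ) := by
    rw [h.csqrt_eq, Complex.add_conj]
  have ha := csqrt_re_nonneg a
  have hb := csqrt_re_nonneg b
  have hc := csqrt_re_nonneg c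
  refine ⟨?_, ?_, ?_⟩
  · rw [add_lam_x, h1, Complex.re_ofReal_mul, Complex.add_re]; positivity
  · rw [add_lam_y, h1, Complex.re_ofReal_mul, Complex.add_re]; positivity
  · have := (h.2.2.2.add h.lam).2; exact this

/-- After one duplication step, `x, y, z` lie in the closed right half plane in all cases. -/
theorem Admissible.next_re_nonneg {x y z p : ℂ} (h : Admissible x y z p) :
    0 ≤ (x + lam x y z).re ∧ 0 ≤ (y + lam x y z).re ∧ 0 ≤ (z + lam x y z).re := by
  have key : 0 ≤ x.re → 0 ≤ y.re → 0 ≤ z.re →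
      0 ≤ (x + lam x y z).re ∧ 0 ≤ (y + lam x y z).re ∧ 0 ≤ (z + lam x y z).re :=
    fun hx hy hz => by
      have := lam_re_nonneg hx hy hz
      simp only [Complex.add_re]
      exact ⟨by linarith, by linarith, by linarith⟩
  rcases h with ⟨hx, hy, hz, -, -⟩ | ⟨-, h | h | h | h⟩
  · exact key hx hy hz
  · exact key h.1.2 h.2.1.2 h.2.2.1.2
  · exact h.next_re_nonneg
  · have := h.next_re_nonneg
    rw [lam_swap_yz] at this
    exact ⟨this.1, this.2.2, this.2.1⟩
  · have := h.next_re_nonneg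
    rw [lam_rotate] at this
    exact ⟨this.2.2, this.1, this.2.1⟩

theorem norm_sub_lt_norm_add {u v : ℂ} (h : 0 < (u * conj v).re) : ‖u - v‖ < ‖u + v‖ := by
  apply lt_of_pow_lt_pow_left₀ 2 (norm_nonneg _)
  rw [← Complex.normSq_eq_norm_sq, ← Complex.normSq_eq_norm_sq, Complex.normSq_sub,
    Complex.normSq_add]
  linarith

theorem norm_sub_le_norm_add {u v : ℂ} (h : 0 ≤ (u * conj v).re) : ‖u - v‖ ≤ ‖u + v‖ := by
  apply le_of_sq_le_sq _ (norm_nonneg _)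
  rw [← Complex.normSq_eq_norm_sq, ← Complex.normSq_eq_norm_sq, Complex.normSq_sub,
    Complex.normSq_add]
  linarith

theorem csqrt_add_re_pos {p x : ℂ} (hp : p ∈ slitPlane) :
    0 < (Complex.sqrt p + Complex.sqrt x).re := by
  have := csqrt_re_pos hp
  have := csqrt_re_nonneg x
  rw [Complex.add_re]; linarith

theorem ne_zero_of_re_pos {w : ℂ} (h : 0 < w.re) : w ≠ 0 := fun h' => by simp [h'] at h

theorem dProd_ne_zero {x y z p : ℂ} (hp : p ∈ slitPlane) : dProd x y z p ≠ 0 :=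
  mul_ne_zero (mul_ne_zero (ne_zero_of_re_pos (csqrt_add_re_pos hp))
    (ne_zero_of_re_pos (csqrt_add_re_pos hp))) (ne_zero_of_re_pos (csqrt_add_re_pos hp))

/-- The numerator of `e`, when `e` is written as a fraction with denominator `d`. -/
noncomputable def eNum (x y z p : ℂ) : ℂ :=
  (Complex.sqrt p - Complex.sqrt x) * (Complex.sqrt p - Complex.sqrt y)
    * (Complex.sqrt p - Complex.sqrt z)

theorem norm_eNum_lt_of_factors {x y z p : ℂ} (hp : p ∈ slitPlane) (h0 : AtMostOneZero x y z)
    (h : ∀ w, (w = x ∨ w = y ∨ w = z) →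
      ‖Complex.sqrt p - Complex.sqrt w‖ ≤ ‖Complex.sqrt p + Complex.sqrt w‖ ∧
      (w ≠ 0 → ‖Complex.sqrt p - Complex.sqrt w‖ < ‖Complex.sqrt p + Complex.sqrt w‖)) :
    ‖eNum x y z p‖ < ‖dProd x y z p‖ := by
  have hpos : ∀ w, 0 < ‖Complex.sqrt p + Complex.sqrt w‖ := fun w =>
    norm_pos_iff.2 (ne_zero_of_re_pos (csqrt_add_re_pos hp))
  obtain ⟨hx, hx'⟩ := h x (by simp)
  obtain ⟨hy, hy'⟩ := h y (by simp)
  obtain ⟨hz, -⟩ := h z (by simp)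
  rw [eNum, dProd, norm_mul, norm_mul, norm_mul, norm_mul]
  have hz0 := hpos z
  have hx0 := hpos x
  have hy0 := hpos y
  have key : ‖Complex.sqrt p - Complex.sqrt x‖ * ‖Complex.sqrt p - Complex.sqrt y‖ <
      ‖Complex.sqrt p + Complex.sqrt x‖ * ‖Complex.sqrt p + Complex.sqrt y‖ := by
    by_cases hxz : x = 0
    · exact mul_lt_mul' hx (hy' fun h => h0.1 ⟨hxz, h⟩) (norm_nonneg _) hx0
    · exact mul_lt_mul (hx' hxz) hy |> fun f => by
        rcases (norm_nonneg (Complex.sqrt p - Complex.sqrt y)).eq_or_lt with h | h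
        · rw [← h, mul_zero]; positivity
        · exact f h hx0.le
  exact mul_lt_mul_of_lt_of_le_of_nonneg_of_pos key hz (by positivity) hz0

theorem ConjPairAndReal.norm_eNum_lt {a b c p : ℂ} (h : ConjPairAndReal a b c)
    (hp : p ∈ slitPlane) : ‖eNum a b c p‖ < ‖dProd a b c p‖ := by
  have hW := csqrt_re_pos hp
  have hA := csqrt_re_pos h.1.mem
  set W := Complex.sqrt p
  set A := Complex.sqrt a with hAdef
  have hC := h.2.2.2.csqrt
  set C := Complex.sqrt c
  have e1 : (W - A) * (W - conj A) = (W * W + A * conj A) - (A + conj A) * W := by ring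
  have e2 : (W + A) * (W + conj A) = (W * W + A * conj A) + (A + conj A) * W := by ring
  have h1 : ‖(W - A) * (W - conj A)‖ < ‖(W + A) * (W + conj A)‖ := by
    rw [e1, e2]
    apply norm_sub_lt_norm_add
    rw [Complex.add_conj, Complex.mul_conj, map_mul, Complex.conj_ofReal,
      show (W * W + ((Complex.normSq A : ℝ) : ℂ)) * (((2 * A.re : ℝ) : ℂ) * conj W)
        = ((2 * A.re : ℝ) : ℂ) * (W * (W * conj W) + ((Complex.normSq A : ℝ) : ℂ) * conj W) by ring,
      Complex.mul_conj, Complex.re_ofReal_mul, Complex.add_re, Complex.re_mul_ofReal,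
      Complex.re_ofReal_mul, Complex.conj_re]
    have : 0 < Complex.normSq W := Complex.normSq_pos.2 (ne_zero_of_re_pos hW)
    have := Complex.normSq_nonneg A
    positivity
  have h2 : ‖W - C‖ ≤ ‖W + C‖ := by
    apply norm_sub_le_norm_add
    have := hC.2
    rw [hC.eq_ofReal, Complex.conj_ofReal, Complex.re_mul_ofReal]
    positivity
  rw [eNum, dProd, h.csqrt_eq, norm_mul _ (W - C), norm_mul _ (W + C)]
  exact mul_lt_mul_of_lt_of_le_of_nonneg_of_pos h1 h2 (norm_nonneg _)
    (norm_pos_iff.2 (ne_zero_of_re_pos (csqrt_add_re_pos hp)))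

theorem Admissible.norm_eNum_lt {x y z p : ℂ} (h : Admissible x y z p) :
    ‖eNum x y z p‖ < ‖dProd x y z p‖ := by
  have hp' := h.p_mem
  have hW := csqrt_re_pos hp'
  rcases h with ⟨hx, hy, hz, h, hp⟩ | ⟨-, h | h | h | h⟩
  · refine norm_eNum_lt_of_factors hp' h fun w hw => ?_
    have hwre : 0 ≤ w.re := by rcases hw with rfl | rfl | rfl <;> assumption
    have hw1 : |(conj (Complex.sqrt w)).im| ≤ (conj (Complex.sqrt w)).re := by
      simpa using abs_im_csqrt_le hwre
    refine ⟨norm_sub_le_norm_add (mul_re_nonneg_of_abs_im_le (abs_im_csqrt_le hp.le) hw1),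
      fun h0 => norm_sub_lt_norm_add (mul_re_pos_of_abs_im_lt (abs_im_csqrt_lt hp) hw1 ?_)⟩
    simpa using csqrt_re_pos ((cutOrZero_of_re_nonneg hwre).mem_of_ne h0)
  · refine norm_eNum_lt_of_factors hp' h.2.2.2 fun w hw => ?_
    have hwr : IsNonnegReal w := by
      rcases hw with rfl | rfl | rfl
      exacts [h.1, h.2.1, h.2.2.1]
    have e : (Complex.sqrt p * conj (Complex.sqrt w)).re
        = (Complex.sqrt p).re * (Complex.sqrt w).re := by
      rw [hwr.csqrt.eq_ofReal, Complex.conj_ofReal, Complex.re_mul_ofReal, Complex.ofReal_re]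
    have h1 := hwr.csqrt.2
    refine ⟨norm_sub_le_norm_add (by rw [e]; positivity),
      fun h0 => norm_sub_lt_norm_add (by
        have := csqrt_re_pos (hwr.cutOrZero.mem_of_ne h0)
        rw [e]; positivity)⟩
  · exact h.norm_eNum_lt hp'
  · have := h.norm_eNum_lt hp'
    have e1 : eNum x z y p = eNum x y z p := by simp only [eNum]; ring
    have e2 : dProd x z y p = dProd x y z p := by simp only [dProd]; ring
    rwa [e1, e2] at this
  · have := h.norm_eNum_lt hp'
    have e1 : eNum y z x p = eNum x y z p := by simp only [eNum]; ring
    have e2 : dProd y z x p = dProd x y z p := by simp only [dProd]; ring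
    rwa [e1, e2] at this

theorem Admissible.norm_eNum_div_lt_one {x y z p : ℂ} (h : Admissible x y z p) :
    ‖eNum x y z p / dProd x y z p‖ < 1 := by
  rw [norm_div, div_lt_one (norm_pos_iff.2 (dProd_ne_zero h.p_mem))]
  exact h.norm_eNum_lt

theorem Admissible.one_add_mem {x y z p : ℂ} (h : Admissible x y z p) :
    1 + eNum x y z p / dProd x y z p ∈ slitPlane :=
  Complex.mem_slitPlane_of_norm_lt_one h.norm_eNum_div_lt_one

theorem eNum_mul_dProd (x y z p : ℂ) :
    eNum x y z p * dProd x y z p = (p - x) * (p - y) * (p - z) := by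
  have hx := csqrt_mul_self x
  have hy := csqrt_mul_self y
  have hz := csqrt_mul_self z
  have hp := csqrt_mul_self p
  rw [eNum, dProd]
  generalize Complex.sqrt x = X at *
  generalize Complex.sqrt y = Y at *
  generalize Complex.sqrt z = Z at *
  generalize Complex.sqrt p = W at *
  rw [← hx, ← hy, ← hz, ← hp]
  ring

/-- The identity `1 + e = 2 √p (p + λ) / d`, cleared of denominators. -/
theorem dProd_add_eNum (x y z p : ℂ) :
    dProd x y z p + eNum x y z p = 2 * Complex.sqrt p * (p + lam x y z) := by
  have := csqrt_mul_self p
  rw [dProd, eNum, lam]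
  linear_combination 2 * Complex.sqrt p * this

/-! ### The duplication theorem -/

/-- The right side of the duplication theorem. -/
noncomputable def duplicated (x y z p : ℂ) : ℂ :=
  1 / 4 * RJ ((x + lam x y z) / 4) ((y + lam x y z) / 4) ((z + lam x y z) / 4)
      ((p + lam x y z) / 4)
    + 6 / dProd x y z p * RC 1 (1 + eNum x y z p / dProd x y z p)

theorem eNum_div_dProd {x y z p : ℂ} (hp : p ∈ slitPlane) :
    eNum x y z p / dProd x y z p = (p - x) * (p - y) * (p - z) / dProd x y z p ^ 2 := by
  have := dProd_ne_zero (x := x) (y := y) (z := z) hp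
  rw [← eNum_mul_dProd]
  field_simp

theorem hasDerivAt_csqrt_add {w : ℂ} (hw : w ∈ slitPlane) :
    HasDerivAt (fun s => Complex.sqrt (w + s)) ((2 * Complex.sqrt w)⁻¹) 0 := by
  have h : HasDerivAt Complex.sqrt ((2 * Complex.sqrt w)⁻¹) (w + 0) := by
    rw [add_zero]; exact hasDerivAt_csqrt hw
  exact (h.comp (0 : ℂ) ((hasDerivAt_id (0 : ℂ)).const_add w)).congr_deriv (mul_one _)

theorem continuousAt_csqrt_add {w : ℂ} (hw : CutOrZero w) :
    ContinuousAt (fun s => Complex.sqrt (w + s)) 0 := by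
  have h : ContinuousAt Complex.sqrt (w + 0) := by
    rw [add_zero]; exact continuousAt_csqrt hw
  exact h.comp (f := fun s => w + s) (by fun_prop)

theorem RJ_next_add (x y z p s : ℂ) :
    RJ ((x + s + lam (x + s) (y + s) (z + s)) / 4) ((y + s + lam (x + s) (y + s) (z + s)) / 4)
      ((z + s + lam (x + s) (y + s) (z + s)) / 4) ((p + s + lam (x + s) (y + s) (z + s)) / 4) =
    (fun u => RJ ((x + lam x y z) / 4 + u) ((y + lam x y z) / 4 + u) ((z + lam x y z) / 4 + u)
      ((p + lam x y z) / 4 + u)) ((s + lam (x + s) (y + s) (z + s) - lam x y z) / 4) := by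
  beta_reduce
  congr 1 <;> ring

theorem Admissible.hasDerivAt_RJ_next {x y z p : ℂ} (h : Admissible x y z p) :
    HasDerivAt (fun u => RJ ((x + lam x y z) / 4 + u) ((y + lam x y z) / 4 + u)
      ((z + lam x y z) / 4 + u) ((p + lam x y z) / 4 + u))
      (-(3 / 2) * rjKernel ((x + lam x y z) / 4) ((y + lam x y z) / 4) ((z + lam x y z) / 4)
        ((p + lam x y z) / 4)) 0 := by
  have hc := h.cutTriple
  exact hasDerivAt_RJ_translate (div_four_mem_slitPlane hc.x_add_lam_mem)
    (div_four_mem_slitPlane hc.y_add_lam_mem) (div_four_mem_slitPlane hc.z_add_lam_mem)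
    (div_four_mem_slitPlane h.p_add_lam_mem)

theorem eventually_add_mem_slitPlane {p : ℂ} (hp : p ∈ slitPlane) :
    ∀ᶠ s in 𝓝 (0 : ℂ), p + s ∈ slitPlane := by
  have : ContinuousAt (fun s : ℂ => p + s) 0 := by fun_prop
  exact this.eventually_mem (by simpa using Complex.isOpen_slitPlane.mem_nhds hp)

/-- Under a common translation of the arguments, the number `e` changes only through `d`. -/
theorem duplicated_add_eventuallyEq {x y z p : ℂ} (hp : p ∈ slitPlane) :
    (fun s => duplicated (x + s) (y + s) (z + s) (p + s)) =ᶠ[𝓝 0] fun s =>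
      1 / 4 * (fun u => RJ ((x + lam x y z) / 4 + u) ((y + lam x y z) / 4 + u)
        ((z + lam x y z) / 4 + u) ((p + lam x y z) / 4 + u))
          ((s + lam (x + s) (y + s) (z + s) - lam x y z) / 4)
      + 6 * ((dProd (x + s) (y + s) (z + s) (p + s))⁻¹ *
        (fun w => RC 1 (1 + w))
          ((p - x) * (p - y) * (p - z) * ((dProd (x + s) (y + s) (z + s) (p + s))⁻¹) ^ 2)) := by
  filter_upwards [eventually_add_mem_slitPlane hp] with s hs
  rw [duplicated, RJ_next_add, eNum_div_dProd hs]
  simp only [add_sub_add_right_eq_sub]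
  rw [inv_pow]
  ring_nf

theorem Admissible.continuousAt_duplicated {x y z p : ℂ} (h : Admissible x y z p) :
    ContinuousAt (fun s => duplicated (x + s) (y + s) (z + s) (p + s)) 0 := by
  have hc := h.cutTriple
  refine ContinuousAt.congr ?_ (duplicated_add_eventuallyEq h.p_mem).symm
  have hX := continuousAt_csqrt_add hc.left
  have hY := continuousAt_csqrt_add hc.mid
  have hZ := continuousAt_csqrt_add hc.right
  have hW := continuousAt_csqrt_add (Or.inr h.p_mem)
  have hL : ContinuousAt (fun s => lam (x + s) (y + s) (z + s)) 0 :=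
    ((hX.mul hY).add (hX.mul hZ)).add (hY.mul hZ)
  have hD : ContinuousAt (fun s => (dProd (x + s) (y + s) (z + s) (p + s))⁻¹) 0 :=
    (((hW.add hX).mul (hW.add hY)).mul (hW.add hZ)).inv₀
      (by simpa [dProd] using dProd_ne_zero h.p_mem)
  obtain ⟨D, hD', -⟩ := exists_hasDerivAt_RC h.one_add_mem
  have h1 := h.hasDerivAt_RJ_next.continuousAt.comp_of_eq
    ((((continuousAt_id (x := (0 : ℂ))).add hL).sub (continuousAt_const (y := lam x y z))).div_const
      4) (by simp)
  have h2 := hD'.continuousAt.comp_of_eq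
    ((continuousAt_const (y := (p - x) * (p - y) * (p - z))).mul (hD.pow 2))
    (by rw [eNum_div_dProd h.p_mem]; simp [div_eq_mul_inv])
  exact (continuousAt_const.mul h1).add (continuousAt_const.mul (hD.mul h2))

theorem hasDerivAt_lam_add {x y z : ℂ} (hx : x ∈ slitPlane) (hy : y ∈ slitPlane)
    (hz : z ∈ slitPlane) :
    HasDerivAt (fun s => lam (x + s) (y + s) (z + s))
      ((Complex.sqrt x + Complex.sqrt y) * (Complex.sqrt x + Complex.sqrt z)
        * (Complex.sqrt y + Complex.sqrt z)
        / (2 * Complex.sqrt x * Complex.sqrt y * Complex.sqrt z) - 1) 0 := by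
  have dX := hasDerivAt_csqrt_add hx
  have dY := hasDerivAt_csqrt_add hy
  have dZ := hasDerivAt_csqrt_add hz
  have hX := csqrt_ne_zero hx
  have hY := csqrt_ne_zero hy
  have hZ := csqrt_ne_zero hz
  refine (((dX.mul dY).add (dX.mul dZ)).add (dY.mul dZ)).congr_deriv ?_
  simp only [add_zero]
  field_simp
  ring

theorem hasDerivAt_dProd_add {x y z p : ℂ} (hx : x ∈ slitPlane) (hy : y ∈ slitPlane)
    (hz : z ∈ slitPlane) (hp : p ∈ slitPlane) :
    HasDerivAt (fun s => dProd (x + s) (y + s) (z + s) (p + s))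
      (dProd x y z p * lam x y z
        / (2 * Complex.sqrt p * Complex.sqrt x * Complex.sqrt y * Complex.sqrt z)) 0 := by
  have dX := hasDerivAt_csqrt_add hx
  have dY := hasDerivAt_csqrt_add hy
  have dZ := hasDerivAt_csqrt_add hz
  have dW := hasDerivAt_csqrt_add hp
  have hX := csqrt_ne_zero hx
  have hY := csqrt_ne_zero hy
  have hZ := csqrt_ne_zero hz
  have hW := csqrt_ne_zero hp
  refine (((dW.add dX).mul (dW.add dY)).mul (dW.add dZ)).congr_deriv ?_
  simp only [Pi.add_apply, Pi.mul_apply, add_zero, dProd, lam]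
  field_simp
  ring

/-- The derivative of the right side of the duplication theorem, under a common translation of the
arguments, is that of the left side. -/
theorem Admissible.hasDerivAt_duplicated {x y z p : ℂ} (h : Admissible x y z p)
    (hx : x ≠ 0) (hy : y ≠ 0) (hz : z ≠ 0) :
    HasDerivAt (fun s => duplicated (x + s) (y + s) (z + s) (p + s))
      (-(3 / 2) * rjKernel x y z p) 0 := by
  have hc := h.cutTriple
  refine HasDerivAt.congr_of_eventuallyEq ?_ (duplicated_add_eventuallyEq h.p_mem)
  have hx' := hc.left.mem_of_ne hx
  have hy' := hc.mid.mem_of_ne hy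
  have hz' := hc.right.mem_of_ne hz
  have dL := hasDerivAt_lam_add hx' hy' hz'
  have hd0 := dProd_ne_zero (x := x) (y := y) (z := z) h.p_mem
  have dD := hasDerivAt_dProd_add hx' hy' hz' h.p_mem
  have dD' := dD.inv (by simpa using hd0)
  obtain ⟨D, hD, hode⟩ := exists_hasDerivAt_RC h.one_add_mem
  have dσ := (((hasDerivAt_id (0 : ℂ)).add dL).sub_const (lam x y z)).div_const 4
  have d1 := h.hasDerivAt_RJ_next.comp_of_eq (0 : ℂ) dσ (by simp)
  have d2 := hD.comp_of_eq (0 : ℂ) ((dD'.pow 2).const_mul ((p - x) * (p - y) * (p - z)))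
    (by rw [eNum_div_dProd h.p_mem]; simp [div_eq_mul_inv])
  refine ((d1.const_mul (1 / 4)).add ((dD'.mul d2).const_mul 6)).congr_deriv ?_
  have hX := csqrt_ne_zero hx'
  have hY := csqrt_ne_zero hy'
  have hZ := csqrt_ne_zero hz'
  have hW := csqrt_ne_zero h.p_mem
  have hXY := ne_zero_of_re_pos hc.re_xy
  have hXZ := ne_zero_of_re_pos hc.re_xz
  have hYZ := ne_zero_of_re_pos hc.re_yz
  have hPL := Complex.slitPlane_ne_zero h.p_add_lam_mem
  have hprod := hc.csqrt_prod_next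
  have e1 := dProd_add_eNum x y z p
  have e2 := eNum_mul_dProd x y z p
  have hp := csqrt_sq p
  simp only [Function.comp_apply, Pi.inv_apply, Pi.pow_apply, add_zero]
  rw [rjKernel, rjKernel, hprod, ← e2]
  have hRC : RC 1 (1 + eNum x y z p / dProd x y z p) =
    (1 + eNum x y z p / dProd x y z p)⁻¹ - 2 * (eNum x y z p / dProd x y z p) * D := by
      linear_combination hode
  have harg : 1 + eNum x y z p * dProd x y z p * (dProd x y z p)⁻¹ ^ 2
      = 1 + eNum x y z p / dProd x y z p := by field_simp
  have h1e : 1 + eNum x y z p / dProd x y z p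
      = 2 * Complex.sqrt p * (p + lam x y z) / dProd x y z p := by
    rw [← e1]; field_simp
  rw [harg, hRC, h1e]
  clear * - hX hY hZ hW hXY hXZ hYZ hPL hd0 hp
  generalize dProd x y z p = d at *
  generalize eNum x y z p = n at *
  generalize lam x y z = l at *
  generalize Complex.sqrt x = X at *
  generalize Complex.sqrt y = Y at *
  generalize Complex.sqrt z = Z at *
  generalize Complex.sqrt p = W at *
  subst hp
  simp only [Nat.cast_ofNat, Nat.add_one_sub_one, pow_one]
  field_simp
  ring

theorem tendsto_csqrt_re_add (w : ℂ) :
    Tendsto (fun t : ℝ => (Complex.sqrt (w + t)).re) atTop atTop := by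
  have h : Tendsto (fun t : ℝ => √(w.re + t)) atTop atTop :=
    Real.tendsto_sqrt_atTop.comp (tendsto_atTop_add_const_left _ _ tendsto_id)
  refine tendsto_atTop_mono (fun t => ?_) h
  rw [csqrt_re]
  apply Real.sqrt_le_sqrt
  have := Complex.re_le_norm (w + t)
  simp only [Complex.add_re, Complex.ofReal_re] at this ⊢
  linarith

theorem tendsto_inv_dProd_add (x y z p : ℂ) :
    Tendsto (fun t : ℝ => (dProd (x + t) (y + t) (z + t) (p + t))⁻¹) atTop (𝓝 0) := by
  have h : ∀ w : ℂ, Tendsto (fun t : ℝ => ‖Complex.sqrt (p + t) + Complex.sqrt (w + t)‖)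
      atTop atTop := fun w => by
    refine tendsto_atTop_mono (fun t => ?_) (tendsto_csqrt_re_add p)
    have h1 := Complex.re_le_norm (Complex.sqrt (p + t) + Complex.sqrt (w + t))
    have h2 := csqrt_re_nonneg (w + t)
    rw [Complex.add_re] at h1
    linarith
  apply tendsto_zero_iff_norm_tendsto_zero.2
  have := (((h x).atTop_mul_atTop₀ (h y)).atTop_mul_atTop₀ (h z)).inv_tendsto_atTop
  refine this.congr fun t => ?_
  simp [dProd]

theorem tendsto_duplicated_add (x y z : ℂ) {p : ℂ} (hp : p ∈ slitPlane) :
    Tendsto (fun t : ℝ => duplicated (x + t) (y + t) (z + t) (p + t)) atTop (𝓝 0) := by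
  have hd := tendsto_inv_dProd_add x y z p
  have h1 : Tendsto (fun t : ℝ => 1 / 4 * RJ ((x + t + lam (x + t) (y + t) (z + t)) / 4)
      ((y + t + lam (x + t) (y + t) (z + t)) / 4) ((z + t + lam (x + t) (y + t) (z + t)) / 4)
      ((p + t + lam (x + t) (y + t) (z + t)) / 4)) atTop (𝓝 0) := by
    rw [← mul_zero (1 / 4 : ℂ)]
    refine Tendsto.const_mul _ ?_
    set K := |x.re| + |y.re| + |z.re| + |p.re| with hK
    have hx := neg_abs_le x.re
    have hy := neg_abs_le y.re
    have hz := neg_abs_le z.re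
    have hp := neg_abs_le p.re
    have hx' := abs_nonneg x.re
    have hy' := abs_nonneg y.re
    have hz' := abs_nonneg z.re
    have hp' := abs_nonneg p.re
    have h0 : Tendsto (fun t : ℝ => 3 / 2 * (∫ t in Ioi (0 : ℝ), majorant t) / ((t - K) / 4))
        atTop (𝓝 0) := by
      apply Tendsto.const_div_atTop
      exact (tendsto_atTop_add_const_right _ (-K) tendsto_id).atTop_div_const (by norm_num)
    apply squeeze_zero_norm' _ h0
    filter_upwards [eventually_ge_atTop (K + 4)] with t ht
    have hl : 0 ≤ (lam (x + t) (y + t) (z + t)).re := by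
      apply lam_re_nonneg <;> simp <;> linarith
    apply norm_RJ_le (by linarith) <;>
      · rw [div_four_re, Complex.add_re, Complex.add_re, Complex.ofReal_re]; linarith
  have h2 : Tendsto (fun t : ℝ => 6 * ((dProd (x + t) (y + t) (z + t) (p + t))⁻¹ *
      RC 1 (1 + (p - x) * (p - y) * (p - z) *
        ((dProd (x + t) (y + t) (z + t) (p + t))⁻¹) ^ 2))) atTop (𝓝 0) := by
    obtain ⟨D, hD, -⟩ := exists_hasDerivAt_RC (w := 0) (by simp)
    have h3 : Tendsto (fun t : ℝ => (p - x) * (p - y) * (p - z) *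
        ((dProd (x + t) (y + t) (z + t) (p + t))⁻¹) ^ 2) atTop (𝓝 0) := by
      simpa using (hd.pow 2).const_mul ((p - x) * (p - y) * (p - z))
    simpa using (hd.mul (hD.continuousAt.tendsto.comp h3)).const_mul 6
  have h3 := h1.add h2
  rw [add_zero] at h3
  refine h3.congr' ?_
  filter_upwards [eventually_ge_atTop 0] with t ht
  have hpt : p + t ∈ slitPlane := by rw [add_comm]; exact add_mem_slitPlane' hp ht
  rw [duplicated, eNum_div_dProd hpt]
  simp only [add_sub_add_right_eq_sub]
  rw [inv_pow]
  ring_nf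

/-- The duplication theorem: the right side, as a function of a common translation `t` of the
arguments, has derivative `-(3 / 2) * rjIntegrand x y z p t` and vanishes at infinity. -/
theorem Admissible.RJ_eq_duplicated {x y z p : ℂ} (h : Admissible x y z p) :
    RJ x y z p = duplicated x y z p := by
  have hc := h.cutTriple
  have hint := integrableOn_rjIntegrand hc.left hc.mid hc.right hc.ne h.p_mem
  have hcont : ContinuousWithinAt
      (fun t : ℝ => duplicated (x + t) (y + t) (z + t) (p + t)) (Ici 0) 0 := by
    refine (ContinuousAt.comp_of_eq (g := fun s : ℂ => duplicated (x + s) (y + s) (z + s) (p + s))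
      h.continuousAt_duplicated Complex.continuous_ofReal.continuousAt ?_).continuousWithinAt
    simp
  have hder : ∀ t ∈ Ioi (0 : ℝ), HasDerivAt
      (fun t : ℝ => duplicated (x + t) (y + t) (z + t) (p + t))
      (-(3 / 2) * rjIntegrand x y z p t) t := fun t ht => by
    have ht : 0 < t := ht
    have ne : ∀ w : ℂ, CutOrZero w → w + t ≠ 0 := fun w hw => by
      rw [add_comm]; exact Complex.slitPlane_ne_zero (add_mem_slitPlane hw ht)
    have h1 := (h.translate ht.le).hasDerivAt_duplicated (ne x hc.left) (ne y hc.mid)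
      (ne z hc.right)
    have h2 : HasDerivAt (fun s : ℂ => duplicated (x + s) (y + s) (z + s) (p + s))
        (-(3 / 2) * rjKernel (x + t) (y + t) (z + t) (p + t)) (t : ℂ) := by
      rw [← sub_self (t : ℂ)] at h1
      have h3 := h1.comp_sub_const (t : ℂ) (t : ℂ)
      refine h3.congr_of_eventuallyEq (Eventually.of_forall fun s => ?_)
      beta_reduce
      congr 1 <;> ring
    have h3 := h2.comp_ofReal
    rw [rjIntegrand_eq_rjKernel]
    simpa only [add_comm (t : ℂ)] using h3
  have hi := integral_Ioi_of_hasDerivAt_of_tendsto hcont hder (hint.const_mul _)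
    (tendsto_duplicated_add x y z h.p_mem)
  rw [integral_const_mul] at hi
  simp only [Complex.ofReal_zero, add_zero, zero_sub] at hi
  rw [RJ]
  linear_combination -hi

/-! ### The iteration -/

theorem iter_succ (x y z p : ℂ) (m : ℕ) : iter x y z p (m + 1) = (iter x y z p m).next := rfl

theorem State.lam_eq (s : State) : s.lam = Carlson.lam s.x s.y s.z := rfl

theorem d_eq (x y z p : ℂ) (m : ℕ) : d x y z p m =
    dProd (iter x y z p m).x (iter x y z p m).y (iter x y z p m).z (iter x y z p m).p := rfl

theorem Admissible.iter {x y z p : ℂ} (h : Admissible x y z p) (m : ℕ) :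
    Admissible (iter x y z p m).x (iter x y z p m).y (iter x y z p m).z (iter x y z p m).p := by
  induction m with
  | zero => exact h
  | succ m ih => exact ih.next

/-- The differences of the five sequences are divided by `4` in each step. -/
theorem iter_diff (x y z p : ℂ) (m : ℕ) :
    4 ^ m * ((iter x y z p m).A - (iter x y z p m).x) = A0 x y z p - x ∧
    4 ^ m * ((iter x y z p m).A - (iter x y z p m).y) = A0 x y z p - y ∧
    4 ^ m * ((iter x y z p m).A - (iter x y z p m).z) = A0 x y z p - z ∧
    4 ^ m * ((iter x y z p m).A - (iter x y z p m).p) = A0 x y z p - p := by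
  induction m with
  | zero => simp [iter]
  | succ m ih =>
    obtain ⟨h1, h2, h3, h4⟩ := ih
    rw [iter_succ]
    simp only [State.next, pow_succ]
    refine ⟨?_, ?_, ?_, ?_⟩
    · linear_combination h1
    · linear_combination h2
    · linear_combination h3
    · linear_combination h4

theorem delta_eq (x y z p : ℂ) (m : ℕ) : delta x y z p = 4 ^ (3 * m) *
    (((iter x y z p m).p - (iter x y z p m).x) * ((iter x y z p m).p - (iter x y z p m).y)
      * ((iter x y z p m).p - (iter x y z p m).z)) := by
  obtain ⟨h1, h2, h3, h4⟩ := iter_diff x y z p m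
  rw [delta, show p - x = (A0 x y z p - x) - (A0 x y z p - p) by ring,
    show p - y = (A0 x y z p - y) - (A0 x y z p - p) by ring,
    show p - z = (A0 x y z p - z) - (A0 x y z p - p) by ring, ← h1, ← h2, ← h3, ← h4]
  ring

theorem Admissible.e_eq {x y z p : ℂ} (h : Admissible x y z p) (m : ℕ) : e x y z p m =
    eNum (Carlson.iter x y z p m).x (Carlson.iter x y z p m).y (Carlson.iter x y z p m).z
      (Carlson.iter x y z p m).p / d x y z p m := by
  rw [d_eq, eNum_div_dProd (h.iter m).p_mem, e, d_eq, delta_eq x y z p m]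
  rw [mul_div_mul_left _ _ (by simp)]

theorem Admissible.duplication {x y z p : ℂ} (h : Admissible x y z p) (m : ℕ) :
    RJ (Carlson.iter x y z p m).x (Carlson.iter x y z p m).y (Carlson.iter x y z p m).z
      (Carlson.iter x y z p m).p =
    1 / 4 * RJ (Carlson.iter x y z p (m + 1)).x (Carlson.iter x y z p (m + 1)).y
      (Carlson.iter x y z p (m + 1)).z (Carlson.iter x y z p (m + 1)).p
      + 6 / d x y z p m * RC 1 (1 + e x y z p m) := by
  rw [(h.iter m).RJ_eq_duplicated, h.e_eq]
  rfl

theorem Admissible.duplication_iterate {x y z p : ℂ} (h : Admissible x y z p) (n : ℕ) :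
    RJ x y z p = 1 / 4 ^ n * RJ (Carlson.iter x y z p n).x (Carlson.iter x y z p n).y
        (Carlson.iter x y z p n).z (Carlson.iter x y z p n).p
      + 6 * ∑ m ∈ Finset.range n, 1 / 4 ^ m / d x y z p m * RC 1 (1 + e x y z p m) := by
  induction n with
  | zero => simp [Carlson.iter]
  | succ n ih =>
    rw [ih, h.duplication n, Finset.sum_range_succ, pow_succ]
    ring

/-! ### Termination -/

/-- Square roots of numbers in the closed right half plane make an angle of at most `π / 2`, so
that the modulus of their sum is bounded below. -/
theorem le_norm_csqrt_add_sq {x y : ℂ} (hx : 0 ≤ x.re) (hy : 0 ≤ y.re) :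
    ‖x‖ + ‖y‖ ≤ ‖Complex.sqrt x + Complex.sqrt y‖ ^ 2 := by
  have h1 : 0 ≤ (Complex.sqrt x * conj (Complex.sqrt y)).re :=
    mul_re_nonneg_of_abs_im_le (abs_im_csqrt_le hx) (by simpa using abs_im_csqrt_le hy)
  rw [← Complex.normSq_eq_norm_sq, Complex.normSq_add, Complex.normSq_eq_norm_sq,
    Complex.normSq_eq_norm_sq, norm_csqrt, norm_csqrt, Real.sq_sqrt (norm_nonneg _),
    Real.sq_sqrt (norm_nonneg _)]
  linarith

theorem le_norm_mul_csqrt_add {x y z : ℂ} {μ : ℝ} (hμ : 0 ≤ μ) (hx : 0 ≤ x.re) (hy : 0 ≤ y.re)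
    (hz : 0 ≤ z.re) (hx' : μ ≤ ‖x‖) (hy' : μ ≤ ‖y‖) (hz' : μ ≤ ‖z‖) :
    2 * μ ≤ ‖(Complex.sqrt x + Complex.sqrt y) * (Complex.sqrt x + Complex.sqrt z)‖ := by
  rw [norm_mul]
  have h1 := le_norm_csqrt_add_sq hx hy
  have h2 := le_norm_csqrt_add_sq hx hz
  apply le_of_sq_le_sq _ (by positivity)
  rw [mul_pow, mul_pow]
  calc 2 ^ 2 * μ ^ 2 = (2 * μ) * (2 * μ) := by ring
    _ ≤ _ := mul_le_mul (by linarith) (by linarith) (by linarith) (by positivity)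

theorem Admissible.exists_le_norm_iter {x y z p : ℂ} (h : Admissible x y z p) :
    ∃ c : ℝ, 0 < c ∧ ∀ n : ℕ, c / 2 ^ n ≤ ‖(Carlson.iter x y z p (n + 1)).x‖ := by
  have hre : ∀ n : ℕ, 0 ≤ (Carlson.iter x y z p (n + 1)).x.re ∧
      0 ≤ (Carlson.iter x y z p (n + 1)).y.re ∧ 0 ≤ (Carlson.iter x y z p (n + 1)).z.re :=
      fun n => by
    have := (h.iter n).next_re_nonneg
    simp only [iter_succ, State.next, State.lam_eq, div_four_re]
    exact ⟨by linarith, by linarith, by linarith⟩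
  have hc := h.cutTriple
  have h1 := norm_pos_iff.2
    (Complex.slitPlane_ne_zero (div_four_mem_slitPlane hc.x_add_lam_mem))
  have h2 := norm_pos_iff.2
    (Complex.slitPlane_ne_zero (div_four_mem_slitPlane hc.y_add_lam_mem))
  have h3 := norm_pos_iff.2
    (Complex.slitPlane_ne_zero (div_four_mem_slitPlane hc.z_add_lam_mem))
  set c := min ‖(x + lam x y z) / 4‖ (min ‖(y + lam x y z) / 4‖ ‖(z + lam x y z) / 4‖) with hcdef
  have hc0 : 0 < c := by positivity
  refine ⟨c, hc0, ?_⟩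
  suffices H : ∀ n : ℕ, c / 2 ^ n ≤ ‖(Carlson.iter x y z p (n + 1)).x‖ ∧
      c / 2 ^ n ≤ ‖(Carlson.iter x y z p (n + 1)).y‖ ∧
      c / 2 ^ n ≤ ‖(Carlson.iter x y z p (n + 1)).z‖ from fun n => (H n).1
  intro n
  induction n with
  | zero =>
    simp only [pow_zero, div_one]
    exact ⟨min_le_left _ _, (min_le_right _ _).trans (min_le_left _ _),
      (min_le_right _ _).trans (min_le_right _ _)⟩
  | succ n ih =>
    obtain ⟨hx, hy, hz⟩ := hre n
    obtain ⟨kx, ky, kz⟩ := ih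
    rw [iter_succ x y z p (n + 1)]
    generalize Carlson.iter x y z p (n + 1) = s at *
    simp only [State.next, State.lam_eq, add_lam_x, add_lam_y, add_lam_z, norm_div,
      Complex.norm_ofNat]
    have hpos : 0 ≤ c / 2 ^ n := by positivity
    have e : c / 2 ^ (n + 1) = 2 * (c / 2 ^ n) / 4 := by rw [pow_succ]; field_simp; norm_num
    rw [e]
    refine ⟨?_, ?_, ?_⟩
    · have := le_norm_mul_csqrt_add hpos hx hy hz kx ky kz
      gcongr
    · have := le_norm_mul_csqrt_add hpos hy hx hz ky kx kz
      rw [add_comm (Complex.sqrt s.y) (Complex.sqrt s.x)] at this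
      gcongr
    · have := le_norm_mul_csqrt_add hpos hz hx hy kz kx ky
      rw [add_comm (Complex.sqrt s.z), add_comm (Complex.sqrt s.z)] at this
      gcongr

/-- The iteration terminates: `x_n` decreases at most like `2 ^ (-n)`, while `4 ^ n (A_n - x_n)` is
constant. -/
theorem Admissible.eventually_mayStop {x y z p : ℂ} (h : Admissible x y z p) (r : ℝ) :
    ∀ᶠ n in atTop, MayStop r x y z p n := by
  obtain ⟨c, hc, hn⟩ := h.exists_le_norm_iter
  rw [← map_add_atTop_eq_nat 1, eventually_map]
  have h1 : Tendsto (fun n : ℕ => 4 * c * (2 : ℝ) ^ n) atTop atTop :=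
    (tendsto_pow_atTop_atTop_of_one_lt one_lt_two).const_mul_atTop (by positivity)
  filter_upwards [h1.eventually_gt_atTop (Q r x y z p + ‖A0 x y z p - x‖)] with n hlarge
  rw [MayStop, div_lt_iff₀ (by positivity)]
  have h2 := (iter_diff x y z p (n + 1)).1
  have h3 := hn n
  generalize Carlson.iter x y z p (n + 1) = s at *
  have h4 : (4 : ℂ) ^ (n + 1) * s.x = 4 ^ (n + 1) * s.A - (A0 x y z p - x) := by
    rw [← h2]; ring
  have h5 := norm_sub_le ((4 : ℂ) ^ (n + 1) * s.A) (A0 x y z p - x)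
  rw [← h4, norm_mul, norm_mul, norm_pow, Complex.norm_ofNat] at h5
  have h6 : 4 * c * 2 ^ n ≤ 4 ^ (n + 1) * ‖s.x‖ := by
    calc 4 * c * 2 ^ n = 4 ^ (n + 1) * (c / 2 ^ n) := by
          rw [show (4 : ℝ) = 2 * 2 by norm_num, pow_succ, mul_pow]; field_simp
      _ ≤ _ := by gcongr
  linarith

/-! ### Taylor approximation of the integrand -/

/-- Power sums of `X, Y, Z, P, P`. -/
noncomputable def psum (X Y Z P : ℂ) (k : ℕ) : ℂ := X ^ k + Y ^ k + Z ^ k + 2 * P ^ k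

/-- The Taylor coefficients at `s = 0` of the reciprocal of
`√(1 - s X) √(1 - s Y) √(1 - s Z) (1 - s P)`, of order two to five, in terms of power sums, when
`X + Y + Z + 2 P = 0`. -/
noncomputable def tcoeff (X Y Z P : ℂ) : ℕ → ℂ
  | 2 => psum X Y Z P 2 / 4
  | 3 => psum X Y Z P 3 / 6
  | 4 => psum X Y Z P 4 / 8 + psum X Y Z P 2 ^ 2 / 32
  | 5 => psum X Y Z P 5 / 10 + psum X Y Z P 2 * psum X Y Z P 3 / 24
  | _ => 0

/-- The Taylor polynomial of degree five of that function. -/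
noncomputable def tpoly (X Y Z P s : ℂ) : ℂ :=
  1 + tcoeff X Y Z P 2 * s ^ 2 + tcoeff X Y Z P 3 * s ^ 3 + tcoeff X Y Z P 4 * s ^ 4
    + tcoeff X Y Z P 5 * s ^ 5

/-- Integration turns the Taylor coefficient of order `N` into its `3 / (3 + 2 N)`-fold; this is the
truncated series. -/
theorem seriesXYZ_eq {X Y Z P : ℂ} (h : X + Y + Z + 2 * P = 0) : seriesXYZ X Y Z =
    1 + 3 / 7 * tcoeff X Y Z P 2 + 3 / 9 * tcoeff X Y Z P 3 + 3 / 11 * tcoeff X Y Z P 4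
      + 3 / 13 * tcoeff X Y Z P 5 := by
  have hP : P = (-X - Y - Z) / 2 := by linear_combination h / 2
  simp only [seriesXYZ, truncatedSeries, ← hP, tcoeff, psum]
  have hX : X = -Y - Z - 2 * P := by linear_combination h
  subst hX
  ring

section TaylorBounds

variable {X Y Z P : ℂ} {ε : ℝ}

theorem norm_psum_le (hX : ‖X‖ ≤ ε) (hY : ‖Y‖ ≤ ε) (hZ : ‖Z‖ ≤ ε) (hP : ‖P‖ ≤ ε) (k : ℕ) :
    ‖psum X Y Z P k‖ ≤ 5 * ε ^ k := by
  have key : ∀ w : ℂ, ‖w‖ ≤ ε → ‖w ^ k‖ ≤ ε ^ k := fun w hw => by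
    rw [norm_pow]; gcongr
  have h2 : ‖(2 : ℂ)‖ ≤ 2 := by simp
  refine (norm_add_le_of_le (norm_add_le_of_le (norm_add_le_of_le (key X hX) (key Y hY)) (key Z hZ))
    (norm_mul_le_of_le h2 (key P hP))).trans (le_of_eq (by ring))

theorem norm_div_ofNat_le {a : ℂ} {A : ℝ} (n : ℕ) [n.AtLeastTwo] (h : ‖a‖ ≤ A) :
    ‖a / (OfNat.ofNat n : ℂ)‖ ≤ A / OfNat.ofNat n := by
  rw [norm_div, Complex.norm_ofNat]
  exact div_le_div_of_nonneg_right h (Nat.cast_nonneg _)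

theorem norm_tcoeff_le (hX : ‖X‖ ≤ ε) (hY : ‖Y‖ ≤ ε) (hZ : ‖Z‖ ≤ ε) (hP : ‖P‖ ≤ ε) :
    ‖tcoeff X Y Z P 2‖ ≤ 5 / 4 * ε ^ 2 ∧ ‖tcoeff X Y Z P 3‖ ≤ 5 / 6 * ε ^ 3 ∧
    ‖tcoeff X Y Z P 4‖ ≤ 45 / 32 * ε ^ 4 ∧ ‖tcoeff X Y Z P 5‖ ≤ 37 / 24 * ε ^ 5 := by
  have h := norm_psum_le hX hY hZ hP
  refine ⟨?_, ?_, ?_, ?_⟩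
  · exact (norm_div_ofNat_le 4 (h 2)).trans (le_of_eq (by ring))
  · exact (norm_div_ofNat_le 6 (h 3)).trans (le_of_eq (by ring))
  · refine (norm_add_le_of_le (norm_div_ofNat_le 8 (h 4)) (norm_div_ofNat_le 32
      ((norm_pow_le' _ two_pos).trans (pow_le_pow_left₀ (norm_nonneg _) (h 2) 2)))).trans
      (le_of_eq (by ring))
  · exact (norm_add_le_of_le (norm_div_ofNat_le 10 (h 5)) (norm_div_ofNat_le 24
      (norm_mul_le_of_le (h 2) (h 3)))).trans (le_of_eq (by ring))

/-- The powers of a number not exceeding `43 / 250`, an upper bound for `(10⁻⁴ / 4) ^ (1 / 6)`. -/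
theorem pow_le_of_le (h0 : 0 ≤ ε) (hε : ε ≤ 43 / 250) (n k : ℕ) :
    ε ^ (n + k) ≤ ε ^ n * (43 / 250) ^ k := by
  rw [pow_add]; gcongr

/-- The function whose reciprocal is approximated by `tpoly`. -/
noncomputable def rootProd (X Y Z P s : ℂ) : ℂ :=
  Complex.sqrt (1 - s * X) * Complex.sqrt (1 - s * Y) * Complex.sqrt (1 - s * Z) * (1 - s * P)

theorem norm_smul_le_of_mem_Icc (h0 : 0 ≤ ε) {s : ℝ} (hs : s ∈ Icc (0 : ℝ) 1)
    (hX : ‖X‖ ≤ ε) : ‖(s : ℂ) * X‖ ≤ ε := by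
  rw [norm_mul, Complex.norm_of_nonneg hs.1]
  nlinarith [hs.1, hs.2, norm_nonneg X]

theorem one_sub_re_pos (hε : ε ≤ 43 / 250) (hX : ‖X‖ ≤ ε) : 0 < (1 - X).re := by
  have := Complex.re_le_norm X
  simp only [Complex.sub_re, Complex.one_re]
  linarith

/-- `1 - rootProd ^ 2` is small, since its linear term vanishes. -/
theorem norm_rootProd_sq_sub_one_le (h0 : 0 ≤ ε) (hε : ε ≤ 43 / 250) (hX : ‖X‖ ≤ ε)
    (hY : ‖Y‖ ≤ ε) (hZ : ‖Z‖ ≤ ε) (hP : ‖P‖ ≤ ε) (h : X + Y + Z + 2 * P = 0) :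
    ‖rootProd X Y Z P 1 ^ 2 - 1‖ ≤ 9 / 100 := by
  have e : rootProd X Y Z P 1 ^ 2 - 1 = -(psum X Y Z P 2 / 2) - psum X Y Z P 3 / 3
      + psum X Y Z P 2 ^ 2 / 8 - psum X Y Z P 4 / 4 - X * Y * Z * P ^ 2 := by
    simp only [rootProd, mul_pow, csqrt_sq, psum]
    have hX : X = -Y - Z - 2 * P := by linear_combination h
    subst hX
    ring
  have hp := norm_psum_le hX hY hZ hP
  rw [e]
  refine (norm_sub_le_of_le (norm_sub_le_of_le (norm_add_le_of_le (norm_sub_le_of_le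
    ((norm_neg _).le.trans (norm_div_ofNat_le 2 (hp 2))) (norm_div_ofNat_le 3 (hp 3)))
    (norm_div_ofNat_le 8 ((norm_pow_le' _ two_pos).trans
      (pow_le_pow_left₀ (norm_nonneg _) (hp 2) 2)))) (norm_div_ofNat_le 4 (hp 4)))
    (norm_mul_le_of_le (norm_mul_le_of_le (norm_mul_le_of_le hX hY) hZ)
      ((norm_pow_le' _ two_pos).trans (pow_le_pow_left₀ (norm_nonneg _) hP 2)))).trans ?_
  have h2 := pow_le_of_le h0 hε 0 2
  have h3 := pow_le_of_le h0 hε 0 3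
  have h4 := pow_le_of_le h0 hε 0 4
  have h5 := pow_le_of_le h0 hε 0 5
  norm_num at h2 h3 h4 h5
  ring_nf
  linarith

theorem norm_rootProd_one_bounds (h0 : 0 ≤ ε) (hε : ε ≤ 43 / 250) (hX : ‖X‖ ≤ ε)
    (hY : ‖Y‖ ≤ ε) (hZ : ‖Z‖ ≤ ε) (hP : ‖P‖ ≤ ε) (h : X + Y + Z + 2 * P = 0) :
    19 / 20 ≤ ‖rootProd X Y Z P 1‖ ∧ ‖rootProd X Y Z P 1‖ ≤ 21 / 20 := by
  have h1 := norm_rootProd_sq_sub_one_le h0 hε hX hY hZ hP h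
  have h2 := norm_sub_norm_le (rootProd X Y Z P 1 ^ 2) 1
  have h3 := norm_sub_norm_le 1 (rootProd X Y Z P 1 ^ 2)
  rw [norm_sub_rev 1] at h3
  rw [norm_pow, norm_one] at h2 h3
  constructor
  · nlinarith [norm_nonneg (rootProd X Y Z P 1)]
  · nlinarith [norm_nonneg (rootProd X Y Z P 1)]

/-- The logarithmic derivative of `rootProd` is `-1 / 2` times a power series with the power sums as
coefficients; this is the remainder of that series from `s ^ 5` on, divided by `s ^ 5`. -/
noncomputable def logRem (X Y Z P s : ℂ) : ℂ :=
  X ^ 6 / (1 - s * X) + Y ^ 6 / (1 - s * Y) + Z ^ 6 / (1 - s * Z) + 2 * (P ^ 6 / (1 - s * P))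

/-- The derivative of `rootProd * tpoly` is `-(1 / 2) * s ^ 5 * rootProd` times this function: all
terms of lower order cancel, by the choice of the coefficients of `tpoly`. -/
noncomputable def derivRem (X Y Z P s : ℂ) : ℂ :=
  let p := psum X Y Z P
  let T := tcoeff X Y Z P
  (p 2 * T 4 + p 3 * T 3 + p 4 * T 2) + s * (p 2 * T 5 + p 3 * T 4 + p 4 * T 3 + p 5 * T 2)
    + s ^ 2 * (p 3 * T 5 + p 4 * T 4 + p 5 * T 3) + s ^ 3 * (p 4 * T 5 + p 5 * T 4)
    + s ^ 4 * (p 5 * T 5) + logRem X Y Z P s * tpoly X Y Z P s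

theorem norm_tpoly_le (h0 : 0 ≤ ε) (hε : ε ≤ 43 / 250) (hX : ‖X‖ ≤ ε)
    (hY : ‖Y‖ ≤ ε) (hZ : ‖Z‖ ≤ ε) (hP : ‖P‖ ≤ ε) {s : ℂ} (hs : ‖s‖ ≤ 1) :
    ‖tpoly X Y Z P s‖ ≤ 21 / 20 := by
  obtain ⟨t2, t3, t4, t5⟩ := norm_tcoeff_le hX hY hZ hP
  have hsk : ∀ k, ‖s ^ k‖ ≤ 1 := fun k => by
    rw [norm_pow]; exact pow_le_one₀ (norm_nonneg _) hs
  refine (norm_add_le_of_le (norm_add_le_of_le (norm_add_le_of_le (norm_add_le_of_le norm_one.le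
    (norm_mul_le_of_le t2 (hsk 2))) (norm_mul_le_of_le t3 (hsk 3)))
    (norm_mul_le_of_le t4 (hsk 4))) (norm_mul_le_of_le t5 (hsk 5))).trans ?_
  have h2 := pow_le_of_le h0 hε 0 2
  have h3 := pow_le_of_le h0 hε 0 3
  have h4 := pow_le_of_le h0 hε 0 4
  have h5 := pow_le_of_le h0 hε 0 5
  norm_num at h2 h3 h4 h5
  linarith

theorem norm_logRem_le (hε : ε ≤ 43 / 250) (hX : ‖X‖ ≤ ε)
    (hY : ‖Y‖ ≤ ε) (hZ : ‖Z‖ ≤ ε) (hP : ‖P‖ ≤ ε) {s : ℂ} (hs : ‖s‖ ≤ 1) :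
    ‖logRem X Y Z P s‖ ≤ 5 * (1250 / 1035 * ε ^ 6) := by
  have key : ∀ w : ℂ, ‖w‖ ≤ ε → ‖w ^ 6 / (1 - s * w)‖ ≤ 1250 / 1035 * ε ^ 6 := fun w hw => by
    have h1 : ‖s * w‖ ≤ 43 / 250 := by
      rw [norm_mul]; nlinarith [norm_nonneg s, norm_nonneg w]
    have h2 := norm_sub_norm_le 1 (s * w)
    rw [norm_one] at h2
    have h3 : ‖w‖ ^ 6 ≤ ε ^ 6 := by gcongr
    have h4 : (0 : ℝ) ≤ ε ^ 6 := by positivity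
    rw [norm_div, norm_pow, div_le_iff₀ (by linarith)]
    nlinarith
  have h2 : ‖(2 : ℂ)‖ ≤ 2 := by simp
  refine (norm_add_le_of_le (norm_add_le_of_le (norm_add_le_of_le (key X hX) (key Y hY)) (key Z hZ))
    (norm_mul_le_of_le h2 (key P hP))).trans (le_of_eq (by ring))

/-- The leading part of `derivRem` contributes less than `17.5 ε ^ 6`, the product of `logRem` and
`tpoly` less than `6.4 ε ^ 6`; the other terms have additional factors `ε`. -/
theorem norm_derivRem_le (h0 : 0 ≤ ε) (hε : ε ≤ 43 / 250) (hX : ‖X‖ ≤ ε)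
    (hY : ‖Y‖ ≤ ε) (hZ : ‖Z‖ ≤ ε) (hP : ‖P‖ ≤ ε) {s : ℂ} (hs : ‖s‖ ≤ 1) :
    ‖derivRem X Y Z P s‖ ≤ 29 * ε ^ 6 := by
  obtain ⟨t2, t3, t4, t5⟩ := norm_tcoeff_le hX hY hZ hP
  have hp := norm_psum_le hX hY hZ hP
  have hsk : ∀ k, ‖s ^ k‖ ≤ 1 := fun k => by
    rw [norm_pow]; exact pow_le_one₀ (norm_nonneg _) hs
  have b0 := norm_add_le_of_le (norm_add_le_of_le (norm_mul_le_of_le (hp 2) t4)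
    (norm_mul_le_of_le (hp 3) t3)) (norm_mul_le_of_le (hp 4) t2)
  have b1 := norm_mul_le_of_le hs (norm_add_le_of_le (norm_add_le_of_le (norm_add_le_of_le
    (norm_mul_le_of_le (hp 2) t5) (norm_mul_le_of_le (hp 3) t4)) (norm_mul_le_of_le (hp 4) t3))
    (norm_mul_le_of_le (hp 5) t2))
  have b2 := norm_mul_le_of_le (hsk 2) (norm_add_le_of_le (norm_add_le_of_le
    (norm_mul_le_of_le (hp 3) t5) (norm_mul_le_of_le (hp 4) t4)) (norm_mul_le_of_le (hp 5) t3))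
  have b3 := norm_mul_le_of_le (hsk 3) (norm_add_le_of_le (norm_mul_le_of_le (hp 4) t5)
    (norm_mul_le_of_le (hp 5) t4))
  have b4 := norm_mul_le_of_le (hsk 4) (norm_mul_le_of_le (hp 5) t5)
  have b5 := norm_mul_le_of_le (norm_logRem_le hε hX hY hZ hP hs)
    (norm_tpoly_le h0 hε hX hY hZ hP hs)
  refine (norm_add_le_of_le (norm_add_le_of_le (norm_add_le_of_le (norm_add_le_of_le
    (norm_add_le_of_le b0 b1) b2) b3) b4) b5).trans ?_
  have h6 : 0 ≤ ε ^ 6 := by positivity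
  have h7 := pow_le_of_le h0 hε 6 1
  have h8 := pow_le_of_le h0 hε 6 2
  have h9 := pow_le_of_le h0 hε 6 3
  have h10 := pow_le_of_le h0 hε 6 4
  norm_num at h7 h8 h9 h10
  ring_nf
  linarith

theorem hasDerivAt_csqrt_one_sub {X s : ℂ} (h : 1 - s * X ∈ slitPlane) :
    HasDerivAt (fun s => Complex.sqrt (1 - s * X))
      (-Complex.sqrt (1 - s * X) * (X / (2 * (1 - s * X)))) s := by
  have h1 : HasDerivAt (fun s : ℂ => 1 - s * X) (-X) s := by
    simpa using ((hasDerivAt_id s).mul_const X).const_sub 1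
  refine ((hasDerivAt_csqrt h).comp s h1).congr_deriv ?_
  have h2 := csqrt_ne_zero h
  have h3 : X / (2 * (1 - s * X)) = X / (2 * Complex.sqrt (1 - s * X) ^ 2) := by rw [csqrt_sq]
  rw [h3]
  field_simp

theorem hasDerivAt_rootProd_mul_tpoly {s : ℂ} (hX : 1 - s * X ∈ slitPlane)
    (hY : 1 - s * Y ∈ slitPlane) (hZ : 1 - s * Z ∈ slitPlane) (hP : 1 - s * P ≠ 0)
    (h : X + Y + Z + 2 * P = 0) :
    HasDerivAt (fun s => rootProd X Y Z P s * tpoly X Y Z P s - 1)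
      (-(1 / 2) * rootProd X Y Z P s * s ^ 5 * derivRem X Y Z P s) s := by
  have h1 : HasDerivAt (fun s : ℂ => 1 - s * P) (-P) s := by
    simpa using ((hasDerivAt_id s).mul_const P).const_sub 1
  have hr := (((hasDerivAt_csqrt_one_sub hX).mul (hasDerivAt_csqrt_one_sub hY)).mul
    (hasDerivAt_csqrt_one_sub hZ)).mul h1
  have ht : HasDerivAt (tpoly X Y Z P) (2 * tcoeff X Y Z P 2 * s + 3 * tcoeff X Y Z P 3 * s ^ 2
      + 4 * tcoeff X Y Z P 4 * s ^ 3 + 5 * tcoeff X Y Z P 5 * s ^ 4) s := by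
    have := (((((hasDerivAt_pow 2 s).const_mul (tcoeff X Y Z P 2)).const_add 1).add
      ((hasDerivAt_pow 3 s).const_mul (tcoeff X Y Z P 3))).add
      ((hasDerivAt_pow 4 s).const_mul (tcoeff X Y Z P 4))).add
      ((hasDerivAt_pow 5 s).const_mul (tcoeff X Y Z P 5))
    refine this.congr_deriv ?_
    push_cast
    ring
  refine ((hr.mul ht).sub_const 1).congr_deriv ?_
  have geom : ∀ w : ℂ, 1 - s * w ≠ 0 → w / (1 - s * w) =
      w + s * w ^ 2 + s ^ 2 * w ^ 3 + s ^ 3 * w ^ 4 + s ^ 4 * w ^ 5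
        + s ^ 5 * (w ^ 6 / (1 - s * w)) := fun w hw => by
    rw [div_eq_iff hw, add_mul, mul_assoc (s ^ 5), div_mul_cancel₀ _ hw]
    ring
  have hX0 := Complex.slitPlane_ne_zero hX
  have hY0 := Complex.slitPlane_ne_zero hY
  have hZ0 := Complex.slitPlane_ne_zero hZ
  have hlog : X / (1 - s * X) + Y / (1 - s * Y) + Z / (1 - s * Z) + 2 * (P / (1 - s * P)) =
      s * psum X Y Z P 2 + s ^ 2 * psum X Y Z P 3 + s ^ 3 * psum X Y Z P 4
        + s ^ 4 * psum X Y Z P 5 + s ^ 5 * logRem X Y Z P s := by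
    rw [geom X hX0, geom Y hY0, geom Z hZ0, geom P hP]
    simp only [psum, logRem]
    linear_combination h
  have hr' : (-Complex.sqrt (1 - s * X) * (X / (2 * (1 - s * X))) * Complex.sqrt (1 - s * Y)
      + Complex.sqrt (1 - s * X) * (-Complex.sqrt (1 - s * Y) * (Y / (2 * (1 - s * Y)))))
        * Complex.sqrt (1 - s * Z) * (1 - s * P)
      + Complex.sqrt (1 - s * X) * Complex.sqrt (1 - s * Y)
        * (-Complex.sqrt (1 - s * Z) * (Z / (2 * (1 - s * Z)))) * (1 - s * P)
      + Complex.sqrt (1 - s * X) * Complex.sqrt (1 - s * Y) * Complex.sqrt (1 - s * Z) * (-P)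
      = -(1 / 2) * rootProd X Y Z P s * (s * psum X Y Z P 2 + s ^ 2 * psum X Y Z P 3
        + s ^ 3 * psum X Y Z P 4 + s ^ 4 * psum X Y Z P 5 + s ^ 5 * logRem X Y Z P s) := by
    rw [← hlog, rootProd]
    field_simp
    ring
  have hfin : (-(1 / 2) * rootProd X Y Z P s * (s * psum X Y Z P 2 + s ^ 2 * psum X Y Z P 3
        + s ^ 3 * psum X Y Z P 4 + s ^ 4 * psum X Y Z P 5 + s ^ 5 * logRem X Y Z P s))
        * tpoly X Y Z P s + rootProd X Y Z P s * (2 * tcoeff X Y Z P 2 * s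
        + 3 * tcoeff X Y Z P 3 * s ^ 2 + 4 * tcoeff X Y Z P 4 * s ^ 3
        + 5 * tcoeff X Y Z P 5 * s ^ 4) =
      -(1 / 2) * rootProd X Y Z P s * s ^ 5 * derivRem X Y Z P s := by
    simp only [derivRem, tpoly, tcoeff]
    ring
  rw [← hfin, ← hr']
  simp only [Pi.mul_apply, rootProd]
  ring

/-- The error of the Taylor polynomial of degree five, with an explicit constant. -/
theorem norm_inv_rootProd_sub_tpoly_le (h0 : 0 ≤ ε) (hε : ε ≤ 43 / 250) (hX : ‖X‖ ≤ ε)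
    (hY : ‖Y‖ ≤ ε) (hZ : ‖Z‖ ≤ ε) (hP : ‖P‖ ≤ ε) (h : X + Y + Z + 2 * P = 0) :
    ‖(rootProd X Y Z P 1)⁻¹ - tpoly X Y Z P 1‖ ≤ 11 / 4 * ε ^ 6 := by
  have hslit : ∀ w : ℂ, ‖w‖ ≤ ε → ∀ s ∈ Icc (0 : ℝ) 1, 1 - (s : ℂ) * w ∈ slitPlane :=
    fun w hw s hs => Or.inl (one_sub_re_pos hε (norm_smul_le_of_mem_Icc h0 hs hw))
  have hder : ∀ s ∈ Icc (0 : ℝ) 1,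
      HasDerivAt (fun s : ℝ => rootProd X Y Z P s * tpoly X Y Z P s - 1)
        (-(1 / 2) * rootProd X Y Z P s * s ^ 5 * derivRem X Y Z P s) s := fun s hs =>
    (hasDerivAt_rootProd_mul_tpoly (hslit X hX s hs) (hslit Y hY s hs) (hslit Z hZ s hs)
      (Complex.slitPlane_ne_zero (hslit P hP s hs)) h).comp_ofReal
  -- the derivative is at most `(1 / 2) (21 / 20) (29 ε ^ 6) s ^ 5`
  have hB : ∀ s : ℝ, HasDerivAt (fun s : ℝ => 203 / 80 * ε ^ 6 * s ^ 6)
      (1218 / 80 * ε ^ 6 * s ^ 5) s := fun s => by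
    refine ((hasDerivAt_pow 6 s).const_mul (203 / 80 * ε ^ 6)).congr_deriv ?_
    push_cast; ring
  have hbound := image_norm_le_of_norm_deriv_right_le_deriv_boundary (a := 0) (b := 1)
    (fun s hs => (hder s hs).continuousAt.continuousWithinAt)
    (fun s hs => (hder s (Ico_subset_Icc_self hs)).hasDerivWithinAt)
    (by simp [rootProd, tpoly]) hB (fun s hs => by
      have hs' := Ico_subset_Icc_self hs
      have h1 : rootProd X Y Z P s = rootProd (s * X) (s * Y) (s * Z) (s * P) 1 := by
        simp [rootProd]
      have h2 := (norm_rootProd_one_bounds h0 hε (norm_smul_le_of_mem_Icc h0 hs' hX)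
        (norm_smul_le_of_mem_Icc h0 hs' hY) (norm_smul_le_of_mem_Icc h0 hs' hZ)
        (norm_smul_le_of_mem_Icc h0 hs' hP)
        (by linear_combination (s : ℂ) * h)).2
      have h3 := norm_derivRem_le h0 hε hX hY hZ hP (s := s)
        (by rw [Complex.norm_of_nonneg hs'.1]; exact hs'.2)
      rw [← h1] at h2
      have h4 : ‖(-(1 / 2) : ℂ)‖ = 1 / 2 := by simp
      have h5 := hs'.1
      rw [norm_mul, norm_mul, norm_mul, norm_pow, Complex.norm_of_nonneg hs'.1, h4]
      calc 1 / 2 * ‖rootProd X Y Z P s‖ * s ^ 5 * ‖derivRem X Y Z P s‖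
          ≤ 1 / 2 * (21 / 20) * s ^ 5 * (29 * ε ^ 6) := by gcongr
        _ = _ := by ring) (right_mem_Icc.2 zero_le_one)
  rw [Complex.ofReal_one] at hbound
  obtain ⟨h1, -⟩ := norm_rootProd_one_bounds h0 hε hX hY hZ hP h
  have hne : rootProd X Y Z P 1 ≠ 0 := norm_pos_iff.1 (by linarith)
  have e : (rootProd X Y Z P 1)⁻¹ - tpoly X Y Z P 1 =
      -((rootProd X Y Z P 1 * tpoly X Y Z P 1 - 1) * (rootProd X Y Z P 1)⁻¹) := by
    field_simp
    ring
  rw [e, norm_neg, norm_mul, norm_inv, ← div_eq_mul_inv, div_le_iff₀ (by linarith)]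
  have h6 : 0 ≤ ε ^ 6 := by positivity
  nlinarith

end TaylorBounds

/-! ### The series approximation of `R_J` -/

theorem cpow_neg_three_halves (A : ℂ) : A ^ (-(3 / 2) : ℂ) = (Complex.sqrt A ^ 3)⁻¹ := by
  rw [Complex.sqrt, ← Complex.cpow_nat_mul, ← Complex.cpow_neg]
  norm_num

theorem rjIntegrand_self (A : ℂ) (t : ℝ) :
    rjIntegrand A A A A t = (Complex.sqrt (t + A) ^ 5)⁻¹ := by
  rw [rjIntegrand, ← mul_inv]
  congr 1
  have := csqrt_sq (t + A)
  generalize Complex.sqrt (t + A) = a at *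
  rw [← this]
  ring

section Expansion

variable {A : ℂ}

theorem add_norm_sq_le (hA : 0 < A.re) {t : ℝ} (ht : 0 ≤ t) :
    t ^ 2 + ‖A‖ ^ 2 ≤ ‖(t : ℂ) + A‖ ^ 2 := by
  rw [← Complex.normSq_eq_norm_sq, ← Complex.normSq_eq_norm_sq, Complex.normSq_apply,
    Complex.normSq_apply]
  simp only [Complex.add_re, Complex.ofReal_re, Complex.add_im, Complex.ofReal_im, zero_add]
  nlinarith [mul_nonneg ht hA.le]

theorem norm_le_norm_add (hA : 0 < A.re) {t : ℝ} (ht : 0 ≤ t) : ‖A‖ ≤ ‖(t : ℂ) + A‖ := by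
  apply le_of_sq_le_sq _ (norm_nonneg _)
  have := add_norm_sq_le hA ht
  nlinarith

theorem re_add_pos (hA : 0 < A.re) {t : ℝ} (ht : 0 ≤ t) : 0 < ((t : ℂ) + A).re := by
  simp; linarith

theorem norm_ratio_le_one (hA : 0 < A.re) {t : ℝ} (ht : 0 ≤ t) : ‖A / (t + A)‖ ≤ 1 := by
  rw [norm_div]
  exact div_le_one_of_le₀ (norm_le_norm_add hA ht) (norm_nonneg _)

theorem continuousOn_ratio_pow (hA : 0 < A.re) (N : ℕ) :
    ContinuousOn (fun t : ℝ => rjIntegrand A A A A t * (A / (t + A)) ^ N) (Ioi 0) := by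
  have hA' : CutOrZero A := Or.inr (Or.inl hA)
  refine (continuousOn_rjIntegrand hA' hA' hA' (Or.inl hA)).mul (ContinuousOn.pow ?_ N)
  refine ContinuousOn.div (by fun_prop) (by fun_prop) fun t ht => ?_
  exact ne_zero_of_re_pos (re_add_pos hA (le_of_lt ht))

theorem integrableOn_rjIntegrand_self (hA : 0 < A.re) :
    IntegrableOn (rjIntegrand A A A A) (Ioi 0) := by
  have hA' : CutOrZero A := Or.inr (Or.inl hA)
  have hA0 := ne_zero_of_re_pos hA
  exact integrableOn_rjIntegrand hA' hA' hA' (atMostOneZero_of_ne hA0 hA0) (Or.inl hA)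

theorem integrableOn_ratio_pow (hA : 0 < A.re) (N : ℕ) :
    IntegrableOn (fun t : ℝ => rjIntegrand A A A A t * (A / (t + A)) ^ N) (Ioi 0) := by
  refine (integrableOn_rjIntegrand_self hA).norm.mono'
    ((continuousOn_ratio_pow hA N).aestronglyMeasurable measurableSet_Ioi)
    ((ae_restrict_iff' measurableSet_Ioi).2 (Eventually.of_forall fun t ht => ?_))
  rw [norm_mul, norm_pow]
  exact mul_le_of_le_one_right (norm_nonneg _)
    (pow_le_one₀ (norm_nonneg _) (norm_ratio_le_one hA (le_of_lt ht)))

theorem tendsto_inv_csqrt_pow (A : ℂ) (k : ℕ) :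
    Tendsto (fun t : ℝ => (Complex.sqrt (t + A) ^ (k + 1))⁻¹) atTop (𝓝 0) := by
  have h1 : Tendsto (fun t : ℝ => ‖Complex.sqrt (t + A)‖) atTop atTop := by
    refine tendsto_atTop_mono (fun t => Complex.re_le_norm _) ?_
    simpa only [add_comm A] using tendsto_csqrt_re_add A
  apply tendsto_zero_iff_norm_tendsto_zero.2
  have := ((tendsto_pow_atTop (n := k + 1) (by simp)).comp h1).inv_tendsto_atTop
  refine this.congr fun t => ?_
  simp

theorem integral_ratio_pow (hA : 0 < A.re) (N : ℕ) :
    ∫ t in Ioi (0 : ℝ), rjIntegrand A A A A t * (A / (t + A)) ^ N =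
      2 / (3 + 2 * N) * (Complex.sqrt A ^ 3)⁻¹ := by
  have hk : (3 + 2 * N : ℂ) ≠ 0 := by exact_mod_cast (by omega : 3 + 2 * N ≠ 0)
  have hder : ∀ t ∈ Ici (0 : ℝ), HasDerivAt
      (fun t : ℝ => -(2 / (3 + 2 * N)) * A ^ N * (Complex.sqrt (t + A) ^ (2 + 2 * N + 1))⁻¹)
      (rjIntegrand A A A A t * (A / (t + A)) ^ N) t := fun t ht => by
    have hs : (t : ℂ) + A ∈ slitPlane := Or.inl (re_add_pos hA ht)
    have h0 := csqrt_ne_zero hs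
    have h1 := (((hasDerivAt_csqrt hs).comp (t : ℂ) ((hasDerivAt_id (t : ℂ)).add_const A)).pow
      (2 + 2 * N + 1)).inv (pow_ne_zero _ h0)
    refine ((h1.comp_ofReal).const_mul (-(2 / (3 + 2 * N)) * A ^ N)).congr_deriv ?_
    have h2 := csqrt_sq (t + A)
    rw [rjIntegrand_self]
    simp only [Function.comp_apply, Pi.pow_apply, id, div_pow, Nat.add_one_sub_one]
    generalize Complex.sqrt (t + A) = a at *
    have e'' : (a ^ 2) ^ N = a ^ (2 * N) := (pow_mul a 2 N).symm
    rw [← h2, e'']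
    push_cast
    have e : (a ^ (2 + 2 * N + 1)) ^ 2 = a ^ (2 * N) * a ^ (2 * N) * a ^ 6 := by ring
    have e' : a ^ (2 + 2 * N) = a ^ (2 * N) * a ^ 2 := by ring
    rw [e, e', show (2 + 2 * (N : ℂ) + 1) = 3 + 2 * N by ring]
    have hne := pow_ne_zero (2 * N) h0
    generalize a ^ (2 * N) = b at *
    field_simp
  have hlim : Tendsto (fun t : ℝ => -(2 / (3 + 2 * N)) * A ^ N *
      (Complex.sqrt (t + A) ^ (2 + 2 * N + 1))⁻¹) atTop (𝓝 0) := by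
    simpa using (tendsto_inv_csqrt_pow A (2 + 2 * N)).const_mul (-(2 / (3 + 2 * N)) * A ^ N)
  rw [integral_Ioi_of_hasDerivAt_of_tendsto' hder (integrableOn_ratio_pow hA N) hlim]
  simp only [Complex.ofReal_zero, zero_add]
  have h2 := csqrt_sq A
  have h0 := csqrt_ne_zero (Or.inl hA)
  generalize Complex.sqrt A = a at *
  rw [← h2, ← pow_mul, show a ^ (2 + 2 * N + 1) = a ^ (2 * N) * a ^ 3 by ring]
  have hne := pow_ne_zero (2 * N) h0
  field_simp
  ring

variable {X Y Z P : ℂ} {ε : ℝ}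

theorem csqrt_add_mul_one_sub (hA : 0 < A.re) (hε : ε ≤ 43 / 250) (hX : ‖X‖ ≤ ε) {t : ℝ}
    (ht : 0 ≤ t) : Complex.sqrt (t + A * (1 - X)) =
      Complex.sqrt (t + A) * Complex.sqrt (1 - A / (t + A) * X) := by
  have h1 := re_add_pos hA ht
  have h2 := ne_zero_of_re_pos h1
  have h3 : ‖A / (t + A) * X‖ ≤ ε := by
    rw [norm_mul]
    exact (mul_le_of_le_one_left (norm_nonneg _) (norm_ratio_le_one hA ht)).trans hX
  rw [← csqrt_mul h1 (one_sub_re_pos hε h3)]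
  congr 1
  field_simp
  ring

theorem rjIntegrand_eq_div_rootProd (hA : 0 < A.re) (hε : ε ≤ 43 / 250) (hX : ‖X‖ ≤ ε)
    (hY : ‖Y‖ ≤ ε) (hZ : ‖Z‖ ≤ ε) {t : ℝ} (ht : 0 ≤ t) :
    rjIntegrand (A * (1 - X)) (A * (1 - Y)) (A * (1 - Z)) (A * (1 - P)) t =
      rjIntegrand A A A A t * (rootProd X Y Z P (A / (t + A)))⁻¹ := by
  have h2 := ne_zero_of_re_pos (re_add_pos hA ht)
  have h3 : (t : ℂ) + A * (1 - P) = (t + A) * (1 - A / (t + A) * P) := by field_simp; ring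
  simp only [rjIntegrand, rootProd, csqrt_add_mul_one_sub hA hε hX ht,
    csqrt_add_mul_one_sub hA hε hY ht, csqrt_add_mul_one_sub hA hε hZ ht, h3, mul_inv]
  ring

/-- The error bound for the integrand, in which `A / (t + A)` supplies the decay. -/
theorem norm_rjIntegrand_sub_le (hA : 0 < A.re) (h0 : 0 ≤ ε) (hε : ε ≤ 43 / 250) (hX : ‖X‖ ≤ ε)
    (hY : ‖Y‖ ≤ ε) (hZ : ‖Z‖ ≤ ε) (hP : ‖P‖ ≤ ε) (h : X + Y + Z + 2 * P = 0) {t : ℝ}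
    (ht : 0 ≤ t) :
    ‖rjIntegrand (A * (1 - X)) (A * (1 - Y)) (A * (1 - Z)) (A * (1 - P)) t
      - rjIntegrand A A A A t * tpoly X Y Z P (A / (t + A))‖ ≤
    11 / 4 * ε ^ 6 * (√‖A‖ ^ 5)⁻¹ * (1 + (2 / ‖A‖ * t) ^ 2)⁻¹ := by
  rw [rjIntegrand_eq_div_rootProd hA hε hX hY hZ ht, ← mul_sub, norm_mul]
  have hw := norm_ratio_le_one hA ht
  have hAn : 0 < ‖A‖ := norm_pos_iff.2 (ne_zero_of_re_pos hA)
  have haA := norm_le_norm_add hA ht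
  have hsq := add_norm_sq_le hA ht
  have haA' := hAn.trans_le haA
  have hrj : ‖rjIntegrand A A A A t‖ ≤ (√‖A‖ ^ 5)⁻¹ * ‖A / (t + A)‖ ^ 2 := by
    rw [rjIntegrand_self, norm_inv, norm_pow, norm_csqrt, norm_div]
    have h1 : √‖A‖ ≤ √‖(t : ℂ) + A‖ := Real.sqrt_le_sqrt haA
    have h2 : 0 < √‖A‖ := Real.sqrt_pos.2 hAn
    have e : (√‖A‖ ^ 5)⁻¹ * (‖A‖ / ‖(t : ℂ) + A‖) ^ 2 = (√‖A‖ * ‖(t : ℂ) + A‖ ^ 2)⁻¹ := by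
      nth_rewrite 2 [← Real.sq_sqrt hAn.le]
      field_simp
    rw [e]
    apply inv_anti₀ (by positivity)
    calc √‖A‖ * ‖(t : ℂ) + A‖ ^ 2 = √‖A‖ * (√‖(t : ℂ) + A‖ ^ 2) ^ 2 := by
          rw [Real.sq_sqrt haA'.le]
      _ ≤ √‖(t : ℂ) + A‖ * (√‖(t : ℂ) + A‖ ^ 2) ^ 2 := by gcongr
      _ = √‖(t : ℂ) + A‖ ^ 5 := by ring
  have hw8 : ‖A / (t + A)‖ ^ 8 ≤ (1 + (2 / ‖A‖ * t) ^ 2)⁻¹ := by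
    rw [norm_div, ← inv_div, inv_pow]
    apply inv_anti₀ (by positivity)
    have hq : 1 + (t / ‖A‖) ^ 2 ≤ (‖(t : ℂ) + A‖ / ‖A‖) ^ 2 := by
      have e : (‖(t : ℂ) + A‖ / ‖A‖) ^ 2 - (1 + (t / ‖A‖) ^ 2)
          = (‖(t : ℂ) + A‖ ^ 2 - (t ^ 2 + ‖A‖ ^ 2)) / ‖A‖ ^ 2 := by field_simp; ring
      have := div_nonneg (sub_nonneg.2 hsq) (sq_nonneg ‖A‖)
      linarith
    -- Bernoulli's inequality
    have h4 := one_add_mul_le_pow (a := (t / ‖A‖) ^ 2) (by nlinarith [sq_nonneg (t / ‖A‖)]) 4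
    have h5 := pow_le_pow_left₀ (by positivity) hq 4
    rw [← pow_mul] at h5
    refine le_trans (le_of_eq ?_) (h4.trans h5)
    push_cast
    ring
  set w := A / ((t : ℂ) + A) with hwdef
  have hscale : ∀ V : ℂ, ‖V‖ ≤ ε → ‖w * V‖ ≤ ‖w‖ * ε := fun V hV => by
    rw [norm_mul]; gcongr
  have h1 := norm_inv_rootProd_sub_tpoly_le (X := w * X) (Y := w * Y) (Z := w * Z) (P := w * P)
    (ε := ‖w‖ * ε) (by positivity) ((mul_le_of_le_one_left h0 hw).trans hε)
    (hscale X hX) (hscale Y hY) (hscale Z hZ) (hscale P hP) (by linear_combination w * h)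
  have e1 : rootProd (w * X) (w * Y) (w * Z) (w * P) 1 = rootProd X Y Z P w := by
    simp [rootProd]
  have e2 : tpoly (w * X) (w * Y) (w * Z) (w * P) 1 = tpoly X Y Z P w := by
    simp only [tpoly, tcoeff, psum]; ring
  rw [e1, e2] at h1
  calc ‖rjIntegrand A A A A t‖ * ‖(rootProd X Y Z P w)⁻¹ - tpoly X Y Z P w‖
      ≤ ((√‖A‖ ^ 5)⁻¹ * ‖w‖ ^ 2) * (11 / 4 * (‖w‖ * ε) ^ 6) := by gcongr
    _ = 11 / 4 * ε ^ 6 * (√‖A‖ ^ 5)⁻¹ * ‖w‖ ^ 8 := by ring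
    _ ≤ _ := by gcongr

/-- The error of the truncated series: the integral of the error of the integrand is estimated by
that of `(1 + 4 t² / |A|²)⁻¹`, and `(3 / 2) (11 / 4) (π / 4) < 13 / 4`. -/
theorem norm_RJ_sub_series_le (hA : 0 < A.re) (h0 : 0 ≤ ε) (hε : ε ≤ 43 / 250) (hX : ‖X‖ ≤ ε)
    (hY : ‖Y‖ ≤ ε) (hZ : ‖Z‖ ≤ ε) (hP : ‖P‖ ≤ ε) (h : X + Y + Z + 2 * P = 0) :
    ‖RJ (A * (1 - X)) (A * (1 - Y)) (A * (1 - Z)) (A * (1 - P))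
      - A ^ (-(3 / 2) : ℂ) * seriesXYZ X Y Z‖ ≤
    13 / 4 * ε ^ 6 * ‖A ^ (-(3 / 2) : ℂ)‖ := by
  have hAn : 0 < ‖A‖ := norm_pos_iff.2 (ne_zero_of_re_pos hA)
  have hmem : ∀ V : ℂ, ‖V‖ ≤ ε → A * (1 - V) ∈ slitPlane := fun V hV =>
    mul_mem_slitPlane hA (one_sub_re_pos hε hV)
  have hint : IntegrableOn (rjIntegrand (A * (1 - X)) (A * (1 - Y)) (A * (1 - Z)) (A * (1 - P)))
      (Ioi 0) :=
    integrableOn_rjIntegrand (Or.inr (hmem X hX)) (Or.inr (hmem Y hY)) (Or.inr (hmem Z hZ))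
      (atMostOneZero_of_ne (Complex.slitPlane_ne_zero (hmem X hX))
        (Complex.slitPlane_ne_zero (hmem Y hY))) (hmem P hP)
  set F : ℕ → ℝ → ℂ := fun N t => rjIntegrand A A A A t * (A / (t + A)) ^ N with hF
  have hi : ∀ N, IntegrableOn (F N) (Ioi 0) := integrableOn_ratio_pow hA
  set T := tcoeff X Y Z P with hT
  have hpoly : (fun t : ℝ => rjIntegrand A A A A t * tpoly X Y Z P (A / (t + A))) = fun t : ℝ =>
      F 0 t + T 2 * F 2 t + T 3 * F 3 t + T 4 * F 4 t + T 5 * F 5 t := by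
    funext t; simp only [tpoly, hF]; ring
  have i2 := (hi 2).const_mul (T 2)
  have i3 := (hi 3).const_mul (T 3)
  have i4 := (hi 4).const_mul (T 4)
  have i5 := (hi 5).const_mul (T 5)
  have j2 : IntegrableOn (fun t => F 0 t + T 2 * F 2 t) (Ioi 0) := (hi 0).add i2
  have j3 : IntegrableOn (fun t => F 0 t + T 2 * F 2 t + T 3 * F 3 t) (Ioi 0) := j2.add i3
  have j4 : IntegrableOn (fun t => F 0 t + T 2 * F 2 t + T 3 * F 3 t + T 4 * F 4 t) (Ioi 0) :=
    j3.add i4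
  have hpint : IntegrableOn (fun t : ℝ => rjIntegrand A A A A t * tpoly X Y Z P (A / (t + A)))
      (Ioi 0) := by
    rw [hpoly]; exact j4.add i5
  have hpval : 3 / 2 * ∫ t in Ioi (0 : ℝ), rjIntegrand A A A A t * tpoly X Y Z P (A / (t + A)) =
      A ^ (-(3 / 2) : ℂ) * seriesXYZ X Y Z := by
    rw [hpoly, integral_add j4 i5, integral_add j3 i4, integral_add j2 i3, integral_add (hi 0) i2]
    simp only [integral_const_mul, hF, integral_ratio_pow hA]
    rw [seriesXYZ_eq h, cpow_neg_three_halves]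
    norm_num
    ring
  have hbint : IntegrableOn (fun t : ℝ => 11 / 4 * ε ^ 6 * (√‖A‖ ^ 5)⁻¹ *
      (1 + (2 / ‖A‖ * t) ^ 2)⁻¹) (Ioi 0) :=
    ((integrable_inv_one_add_sq.comp_mul_left' (by positivity)).const_mul _).integrableOn
  have hbval : ∫ t in Ioi (0 : ℝ), 11 / 4 * ε ^ 6 * (√‖A‖ ^ 5)⁻¹ * (1 + (2 / ‖A‖ * t) ^ 2)⁻¹ =
      11 / 4 * ε ^ 6 * (√‖A‖ ^ 5)⁻¹ * (‖A‖ / 2 * (Real.pi / 2)) := by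
    rw [integral_const_mul, integral_comp_mul_left_Ioi (fun s : ℝ => (1 + s ^ 2)⁻¹) 0
      (by positivity : 0 < 2 / ‖A‖), mul_zero, integral_Ioi_inv_one_add_sq]
    simp
  have e : RJ (A * (1 - X)) (A * (1 - Y)) (A * (1 - Z)) (A * (1 - P))
      - A ^ (-(3 / 2) : ℂ) * seriesXYZ X Y Z = 3 / 2 * ∫ t in Ioi (0 : ℝ),
        (rjIntegrand (A * (1 - X)) (A * (1 - Y)) (A * (1 - Z)) (A * (1 - P)) t
          - rjIntegrand A A A A t * tpoly X Y Z P (A / (t + A))) := by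
    rw [integral_sub hint hpint, mul_sub (3 / 2 : ℂ), hpval, RJ]
  have hle := norm_integral_le_of_norm_le hbint
    ((ae_restrict_iff' measurableSet_Ioi).2 (Eventually.of_forall fun t ht =>
      norm_rjIntegrand_sub_le hA h0 hε hX hY hZ hP h (le_of_lt ht)))
  rw [hbval] at hle
  have hnorm : ‖A ^ (-(3 / 2) : ℂ)‖ = (√‖A‖ ^ 3)⁻¹ := by
    rw [cpow_neg_three_halves, norm_inv, norm_pow, norm_csqrt]
  have hpi := Real.pi_lt_d4
  have hs : 0 < √‖A‖ := Real.sqrt_pos.2 hAn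
  have e5 : (√‖A‖ ^ 5)⁻¹ * ‖A‖ = (√‖A‖ ^ 3)⁻¹ := by
    nth_rewrite 2 [← Real.sq_sqrt hAn.le]; field_simp
  have h6 : 0 ≤ ε ^ 6 * (√‖A‖ ^ 3)⁻¹ := by positivity
  rw [e, norm_mul, hnorm]
  calc ‖(3 / 2 : ℂ)‖ * _ ≤ 3 / 2 * (11 / 4 * ε ^ 6 * (√‖A‖ ^ 5)⁻¹ * (‖A‖ / 2 * (Real.pi / 2))) := by
        gcongr; norm_num
    _ = 33 / 32 * Real.pi * (ε ^ 6 * ((√‖A‖ ^ 5)⁻¹ * ‖A‖)) := by ring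
    _ ≤ 13 / 4 * ε ^ 6 * (√‖A‖ ^ 3)⁻¹ := by rw [e5]; nlinarith

theorem norm_seriesXYZ_sub_one_le (h0 : 0 ≤ ε) (hε : ε ≤ 43 / 250) (hX : ‖X‖ ≤ ε)
    (hY : ‖Y‖ ≤ ε) (hZ : ‖Z‖ ≤ ε) (hP : ‖P‖ ≤ ε) (h : X + Y + Z + 2 * P = 0) :
    ‖seriesXYZ X Y Z - 1‖ ≤ 1 / 50 := by
  obtain ⟨t2, t3, t4, t5⟩ := norm_tcoeff_le hX hY hZ hP
  have e : seriesXYZ X Y Z - 1 = 3 / 7 * tcoeff X Y Z P 2 + 3 / 9 * tcoeff X Y Z P 3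
      + 3 / 11 * tcoeff X Y Z P 4 + 3 / 13 * tcoeff X Y Z P 5 := by
    rw [seriesXYZ_eq h]; ring
  rw [e]
  refine (norm_add_le_of_le (norm_add_le_of_le (norm_add_le_of_le
    (norm_mul_le_of_le (le_of_eq ?_) t2) (norm_mul_le_of_le (le_of_eq ?_) t3))
    (norm_mul_le_of_le (le_of_eq ?_) t4)) (norm_mul_le_of_le (le_of_eq ?_) t5)).trans
    (?_ : 3 / 7 * (5 / 4 * ε ^ 2) + 3 / 9 * (5 / 6 * ε ^ 3) + 3 / 11 * (45 / 32 * ε ^ 4)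
      + 3 / 13 * (37 / 24 * ε ^ 5) ≤ 1 / 50)
  · simp
  · simp
  · simp
  · simp
  · have h2 := pow_le_of_le h0 hε 0 2
    have h3 := pow_le_of_le h0 hε 0 3
    have h4 := pow_le_of_le h0 hε 0 4
    have h5 := pow_le_of_le h0 hε 0 5
    norm_num at h2 h3 h4 h5
    linarith

end Expansion

/-! ### Stopping the iteration -/

theorem sum_A0_sub_eq_zero (x y z p : ℂ) :
    (A0 x y z p - x) + (A0 x y z p - y) + (A0 x y z p - z) + 2 * (A0 x y z p - p) = 0 := by
  rw [A0]; ring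

section Stopping

variable {r : ℝ} {x y z p : ℂ} {n : ℕ}

theorem mayStop_bound (hr : 0 < r) (hn : MayStop r x y z p n) {w : ℂ}
    (hw : ‖w‖ ≤ max (max ‖A0 x y z p - x‖ ‖A0 x y z p - y‖)
      (max ‖A0 x y z p - z‖ ‖A0 x y z p - p‖)) :
    ‖w‖ < (r / 4) ^ (1 / 6 : ℝ) * (4 ^ n * ‖(iter x y z p n).A‖) := by
  rw [MayStop, Q, div_lt_iff₀ (by positivity), Real.rpow_neg (by positivity),
    inv_mul_lt_iff₀ (by positivity)] at hn
  linarith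

theorem MayStop.A_ne_zero (hr : 0 < r) (hn : MayStop r x y z p n) : (iter x y z p n).A ≠ 0 := by
  intro h
  have := mayStop_bound hr hn (w := A0 x y z p - x) ((le_max_left _ _).trans (le_max_left _ _))
  rw [h, norm_zero, mul_zero, mul_zero] at this
  exact absurd this (not_lt.2 (norm_nonneg _))

theorem mayStop_ratio_le (hr : 0 < r) (hn : MayStop r x y z p n) {w : ℂ}
    (hw : ‖w‖ ≤ max (max ‖A0 x y z p - x‖ ‖A0 x y z p - y‖)
      (max ‖A0 x y z p - z‖ ‖A0 x y z p - p‖)) :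
    ‖w / (4 ^ n * (iter x y z p n).A)‖ ≤ (r / 4) ^ (1 / 6 : ℝ) := by
  have hA := norm_pos_iff.2 (hn.A_ne_zero hr)
  rw [norm_div, norm_mul, norm_pow, Complex.norm_ofNat, div_le_iff₀ (by positivity)]
  exact (mayStop_bound hr hn hw).le

theorem rpow_sixth_pow (hr : 0 < r) : ((r / 4) ^ (1 / 6 : ℝ)) ^ 6 = r / 4 := by
  rw [← Real.rpow_natCast, ← Real.rpow_mul (by positivity)]
  norm_num

theorem rpow_sixth_le (hr : 0 < r) (hr' : r < 1 / 10 ^ 4) : (r / 4) ^ (1 / 6 : ℝ) ≤ 43 / 250 := by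
  apply le_of_pow_le_pow_left₀ (n := 6) (by norm_num) (by norm_num)
  rw [rpow_sixth_pow hr]
  norm_num at hr' ⊢
  linarith

/-- The ratios `X, Y, Z, P` of the series, when the iteration may be stopped. -/
structure StopData (A x y z p X Y Z P : ℂ) (ε : ℝ) : Prop where
  hx : x = A * (1 - X)
  hy : y = A * (1 - Y)
  hz : z = A * (1 - Z)
  hp : p = A * (1 - P)
  X_le : ‖X‖ ≤ ε
  Y_le : ‖Y‖ ≤ ε
  Z_le : ‖Z‖ ≤ ε
  P_le : ‖P‖ ≤ ε
  sum : X + Y + Z + 2 * P = 0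

theorem MayStop.stopData (hr : 0 < r) (hn : MayStop r x y z p n) :
    StopData (iter x y z p n).A (iter x y z p n).x (iter x y z p n).y (iter x y z p n).z
      (iter x y z p n).p ((A0 x y z p - x) / (4 ^ n * (iter x y z p n).A))
      ((A0 x y z p - y) / (4 ^ n * (iter x y z p n).A))
      ((A0 x y z p - z) / (4 ^ n * (iter x y z p n).A))
      ((A0 x y z p - p) / (4 ^ n * (iter x y z p n).A)) ((r / 4) ^ (1 / 6 : ℝ)) := by
  have hA := hn.A_ne_zero hr
  have h4 : (4 : ℂ) ^ n ≠ 0 := by simp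
  obtain ⟨h1, h2, h3, h5⟩ := iter_diff x y z p n
  constructor
  · rw [← h1]; field_simp; ring
  · rw [← h2]; field_simp; ring
  · rw [← h3]; field_simp; ring
  · rw [← h5]; field_simp; ring
  · exact mayStop_ratio_le hr hn ((le_max_left _ _).trans (le_max_left _ _))
  · exact mayStop_ratio_le hr hn ((le_max_right _ _).trans (le_max_left _ _))
  · exact mayStop_ratio_le hr hn ((le_max_left _ _).trans (le_max_right _ _))
  · exact mayStop_ratio_le hr hn ((le_max_right _ _).trans (le_max_right _ _))
  · rw [← add_div, ← add_div, ← mul_div_assoc, ← add_div, sum_A0_sub_eq_zero, zero_div]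

theorem StopData.five_mul {A X Y Z P : ℂ} {ε : ℝ} (h : StopData A x y z p X Y Z P ε) :
    5 * A = x + y + z + 2 * p := by
  rw [h.hx, h.hy, h.hz, h.hp]
  linear_combination A * h.sum

theorem StopData.re_pos_of_nonnegReal {A w V : ℂ} (hw : IsNonnegReal w) (h : w = A * (1 - V))
    (hA : A ≠ 0) (hV : ‖V‖ < 1) : 0 < A.re := by
  have h1 : ‖A - w‖ < ‖A‖ := by
    rw [h, show A - A * (1 - V) = A * V by ring, norm_mul]
    exact mul_lt_of_lt_one_right (norm_pos_iff.2 hA) hV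
  by_contra hre
  have h2 : ‖A‖ ≤ ‖A - w‖ := by
    apply le_of_sq_le_sq _ (norm_nonneg _)
    rw [← Complex.normSq_eq_norm_sq, ← Complex.normSq_eq_norm_sq, Complex.normSq_apply,
      Complex.normSq_apply, Complex.sub_re, Complex.sub_im, hw.1]
    nlinarith [hw.2, mul_nonneg hw.2 (neg_nonneg.2 (not_lt.1 hre))]
  linarith

/-- When the iteration may be stopped, `A_n` lies in the right half plane: among `x_n, y_n, z_n` one
is real and nonnegative, and close to `A_n`, or else all real parts are nonnegative. -/
theorem StopData.re_pos {A X Y Z P : ℂ} {ε : ℝ} (h : StopData A x y z p X Y Z P ε)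
    (hadm : Admissible x y z p) (hε : ε ≤ 43 / 250) (hA : A ≠ 0) : 0 < A.re := by
  have hX : ‖X‖ < 1 := by linarith [h.X_le]
  have hY : ‖Y‖ < 1 := by linarith [h.Y_le]
  have hZ : ‖Z‖ < 1 := by linarith [h.Z_le]
  rcases hadm with ⟨hx, hy, hz, -, hp⟩ | ⟨-, hr | hc | hc | hc⟩
  · have h5 := congrArg Complex.re h.five_mul
    rw [show (5 : ℂ) = ((5 : ℝ) : ℂ) by norm_num, show (2 : ℂ) = ((2 : ℝ) : ℂ) by norm_num] at h5
    simp only [Complex.add_re, Complex.re_ofReal_mul] at h5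
    linarith
  · exact re_pos_of_nonnegReal hr.1 h.hx hA hX
  · exact re_pos_of_nonnegReal hc.2.2.2 h.hz hA hZ
  · exact re_pos_of_nonnegReal hc.2.2.2 h.hy hA hY
  · exact re_pos_of_nonnegReal hc.2.2.2 h.hx hA hX

theorem Admissible.relErrLT_seriesApprox (hadm : Admissible x y z p) (hr : 0 < r)
    (hr' : r < 1 / 10 ^ 4) (hn : MayStop r x y z p n) :
    RelErrLT r (RJ (Carlson.iter x y z p n).x (Carlson.iter x y z p n).y
      (Carlson.iter x y z p n).z (Carlson.iter x y z p n).p) (seriesApprox x y z p n) := by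
  have hs := hn.stopData hr
  have hA := hn.A_ne_zero hr
  have hε := rpow_sixth_le hr hr'
  have hre := hs.re_pos (hadm.iter n) hε hA
  have h0 : (0 : ℝ) ≤ (r / 4) ^ (1 / 6 : ℝ) := by positivity
  have herr := norm_RJ_sub_series_le hre h0 hε hs.X_le hs.Y_le hs.Z_le hs.P_le hs.sum
  rw [← hs.hx, ← hs.hy, ← hs.hz, ← hs.hp, rpow_sixth_pow hr] at herr
  have hone := norm_seriesXYZ_sub_one_le h0 hε hs.X_le hs.Y_le hs.Z_le hs.P_le hs.sum
  rw [RelErrLT]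
  simp only [seriesApprox]
  refine herr.trans_lt ?_
  rw [norm_mul]
  generalize seriesXYZ _ _ _ = S at *
  have hS := norm_sub_norm_le 1 S
  rw [norm_one, norm_sub_rev] at hS
  have hpow : 0 < ‖(Carlson.iter x y z p n).A ^ (-(3 / 2) : ℂ)‖ :=
    norm_pos_iff.2 (by simp [Complex.cpow_eq_zero_iff, hA])
  have : 13 / 16 * r < r * ‖S‖ := by nlinarith
  nlinarith

theorem Admissible.norm_RJ_sub_approx_lt (hadm : Admissible x y z p) (hr : 0 < r)
    (hr' : r < 1 / 10 ^ 4) (hn : MayStop r x y z p n) {ρ : ℕ → ℂ}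
    (hρ : ∀ m < n, RelErrLT r (RC 1 (1 + e x y z p m)) (ρ m)) :
    ‖RJ x y z p - approx x y z p ρ n‖ < r * approxAbs x y z p ρ n := by
  have h1 := hadm.relErrLT_seriesApprox hr hr' hn
  rw [RelErrLT] at h1
  rw [hadm.duplication_iterate n, approx, approxAbs]
  generalize RJ (Carlson.iter x y z p n).x _ _ _ = R at *
  have e1 : (1 / 4 ^ n * R + 6 * ∑ m ∈ Finset.range n,
        1 / 4 ^ m / d x y z p m * RC 1 (1 + e x y z p m))
      - (1 / 4 ^ n * seriesApprox x y z p n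
        + 6 * ∑ m ∈ Finset.range n, 1 / 4 ^ m / d x y z p m * ρ m) =
      1 / 4 ^ n * (R - seriesApprox x y z p n) + 6 * ∑ m ∈ Finset.range n,
        1 / 4 ^ m / d x y z p m * (RC 1 (1 + e x y z p m) - ρ m) := by
    simp only [mul_sub, Finset.sum_sub_distrib]
    ring
  have h2 : ‖1 / 4 ^ n * (R - seriesApprox x y z p n)‖ <
      r * ‖1 / 4 ^ n * seriesApprox x y z p n‖ := by
    rw [norm_mul, norm_mul, mul_left_comm]
    exact mul_lt_mul_of_pos_left h1 (norm_pos_iff.2 (by simp))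
  have h3 : ‖∑ m ∈ Finset.range n, 1 / 4 ^ m / d x y z p m * (RC 1 (1 + e x y z p m) - ρ m)‖ ≤
      ∑ m ∈ Finset.range n, r * ‖1 / 4 ^ m / d x y z p m * ρ m‖ := by
    refine norm_sum_le_of_le _ fun m hm => ?_
    rw [norm_mul, norm_mul, mul_left_comm]
    exact mul_le_mul_of_nonneg_left (hρ m (Finset.mem_range.1 hm)).le (norm_nonneg _)
  rw [← Finset.mul_sum] at h3
  rw [e1]
  refine (norm_add_le _ _).trans_lt ?_
  rw [norm_mul 6, Complex.norm_ofNat]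
  linarith

/-! ### Real results -/

/-- The cases in which `x, y, z` are real, or real and a conjugate pair, and `p` is real. -/
structure RealCase (x y z p : ℂ) : Prop where
  p_im : p.im = 0
  p_re : 0 < p.re
  triple : RealTriple x y z ∨ ConjTriple x y z

theorem RealCase.lam (h : RealCase x y z p) : IsNonnegReal (lam x y z) :=
  h.triple.elim RealTriple.lam ConjTriple.lam

theorem RealCase.iter (h : RealCase x y z p) (m : ℕ) :
    RealCase (iter x y z p m).x (iter x y z p m).y (iter x y z p m).z (iter x y z p m).p := by
  induction m with
  | zero => exact h
  | succ m ih =>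
    have hp : IsNonnegReal (Carlson.iter x y z p m).p := ⟨ih.p_im, ih.p_re.le⟩
    refine ⟨((hp.add ih.lam).div_four).1, ?_, Admissible.real_or_conj_next ih.triple⟩
    rw [iter_succ]
    simp only [State.next, State.lam_eq, div_four_re, Complex.add_re]
    linarith [ih.p_re, ih.lam.2]

theorem RealCase.csqrt_p (h : RealCase x y z p) : IsNonnegReal (Complex.sqrt p) :=
  IsNonnegReal.csqrt ⟨h.p_im, h.p_re.le⟩

theorem ConjPairAndReal.dProd_nonneg {a b c p : ℂ} (h : ConjPairAndReal a b c)
    (hp : IsNonnegReal (Complex.sqrt p)) : IsNonnegReal (dProd a b c p) := by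
  have e1 : Complex.sqrt p + Complex.sqrt b = conj (Complex.sqrt p + Complex.sqrt a) := by
    rw [map_add, h.csqrt_eq, Complex.conj_eq_iff_im.2 hp.1]
  rw [dProd, e1]
  exact (isNonnegReal_mul_conj _).mul (hp.add h.2.2.2.csqrt)

theorem RealCase.dProd (h : RealCase x y z p) : IsNonnegReal (dProd x y z p) := by
  have hp := h.csqrt_p
  rcases h.triple with k | k | k | k
  · exact ((hp.add k.1.csqrt).mul (hp.add k.2.1.csqrt)).mul (hp.add k.2.2.1.csqrt)
  · exact k.dProd_nonneg hp
  · have := k.dProd_nonneg hp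
    rwa [show Carlson.dProd x z y p = Carlson.dProd x y z p by simp only [Carlson.dProd]; ring]
      at this
  · have := k.dProd_nonneg hp
    rwa [show Carlson.dProd y z x p = Carlson.dProd x y z p by simp only [Carlson.dProd]; ring]
      at this

theorem conj_seriesXYZ (X Y Z : ℂ) :
    conj (seriesXYZ X Y Z) = seriesXYZ (conj X) (conj Y) (conj Z) := by
  simp [seriesXYZ, truncatedSeries, map_ofNat]

theorem seriesXYZ_swap_xy (X Y Z : ℂ) : seriesXYZ Y X Z = seriesXYZ X Y Z := by
  simp only [seriesXYZ, truncatedSeries]; ring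

theorem seriesXYZ_swap_xz (X Y Z : ℂ) : seriesXYZ Z Y X = seriesXYZ X Y Z := by
  simp only [seriesXYZ, truncatedSeries]; ring

theorem seriesXYZ_swap_yz (X Y Z : ℂ) : seriesXYZ X Z Y = seriesXYZ X Y Z := by
  simp only [seriesXYZ, truncatedSeries]; ring

theorem IsNonnegReal.inv {a : ℂ} (ha : IsNonnegReal a) : IsNonnegReal a⁻¹ := by
  rw [ha.eq_ofReal, ← Complex.ofReal_inv]; exact isNonnegReal_ofReal (inv_nonneg.2 ha.2)

theorem IsNonnegReal.pow {a : ℂ} (ha : IsNonnegReal a) (k : ℕ) : IsNonnegReal (a ^ k) := by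
  rw [ha.eq_ofReal, ← Complex.ofReal_pow]; exact isNonnegReal_ofReal (pow_nonneg ha.2 k)

theorem IsNonnegReal.norm_eq {a : ℂ} (ha : IsNonnegReal a) : ‖a‖ = a.re := by
  conv_lhs => rw [ha.eq_ofReal]
  exact Complex.norm_of_nonneg ha.2

theorem IsNonnegReal.conj_eq {a : ℂ} (ha : IsNonnegReal a) : conj a = a :=
  Complex.conj_eq_iff_im.2 ha.1

theorem RealCase.A_im {A X Y Z P : ℂ} {ε : ℝ} (h : RealCase x y z p)
    (hs : StopData A x y z p X Y Z P ε) : A.im = 0 := by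
  have h5 := congrArg Complex.im hs.five_mul
  rw [show (5 : ℂ) = ((5 : ℝ) : ℂ) by norm_num, show (2 : ℂ) = ((2 : ℝ) : ℂ) by norm_num] at h5
  simp only [Complex.add_im, Complex.im_ofReal_mul, h.p_im] at h5
  rcases h.triple with k | k | k | k
  · have := k.1.1; have := k.2.1.1; have := k.2.2.1.1
    linarith
  all_goals
    have h1 := k.2.2.2.1
    have h2 := congrArg Complex.im k.2.2.1
    rw [Complex.star_def, Complex.conj_im] at h2
    linarith

theorem RealCase.series_im {A X Y Z P : ℂ} {ε : ℝ} (h : RealCase x y z p)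
    (hs : StopData A x y z p X Y Z P ε) (hA : A ≠ 0) : (seriesXYZ X Y Z).im = 0 := by
  rw [← Complex.conj_eq_iff_im, conj_seriesXYZ]
  have hAc : conj A = A := Complex.conj_eq_iff_im.2 (h.A_im hs)
  -- complex conjugation acts on `X, Y, Z` as it does on `x, y, z`
  have key : ∀ {v w V W : ℂ}, v = A * (1 - V) → w = A * (1 - W) → conj v = w → conj V = W :=
    fun {v w V W} hv hw hvw => by
      rw [hv, hw, map_mul, hAc, map_sub, map_one] at hvw
      have := mul_left_cancel₀ hA hvw
      linear_combination -this
  rcases h.triple with k | k | k | k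
  · rw [key hs.hx hs.hx k.1.conj_eq, key hs.hy hs.hy k.2.1.conj_eq,
      key hs.hz hs.hz k.2.2.1.conj_eq]
  · obtain ⟨-, -, k1, k2⟩ := k
    have k1' : conj x = y := k1.symm
    rw [key hs.hx hs.hy k1', key hs.hy hs.hx (by rw [← k1', Complex.conj_conj]),
      key hs.hz hs.hz k2.conj_eq, seriesXYZ_swap_xy]
  · obtain ⟨-, -, k1, k2⟩ := k
    have k1' : conj x = z := k1.symm
    rw [key hs.hx hs.hz k1', key hs.hz hs.hx (by rw [← k1', Complex.conj_conj]),
      key hs.hy hs.hy k2.conj_eq, seriesXYZ_swap_xz]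
  · obtain ⟨-, -, k1, k2⟩ := k
    have k1' : conj y = z := k1.symm
    rw [key hs.hy hs.hz k1', key hs.hz hs.hy (by rw [← k1', Complex.conj_conj]),
      key hs.hx hs.hx k2.conj_eq, seriesXYZ_swap_yz]

theorem seriesApprox_nonneg (hadm : Admissible x y z p) (h : RealCase x y z p) (hr : 0 < r)
    (hr' : r < 1 / 10 ^ 4) (hn : MayStop r x y z p n) : IsNonnegReal (seriesApprox x y z p n) := by
  have hs := hn.stopData hr
  have hA := hn.A_ne_zero hr
  have hε := rpow_sixth_le hr hr'
  have hre := hs.re_pos (hadm.iter n) hε hA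
  have h0 : (0 : ℝ) ≤ (r / 4) ^ (1 / 6 : ℝ) := by positivity
  have hone := norm_seriesXYZ_sub_one_le h0 hε hs.X_le hs.Y_le hs.Z_le hs.P_le hs.sum
  have him := (h.iter n).series_im hs hA
  have hAr : IsNonnegReal (iter x y z p n).A := ⟨(h.iter n).A_im hs, hre.le⟩
  simp only [seriesApprox, cpow_neg_three_halves]
  refine ((hAr.csqrt.pow 3).inv).mul ⟨him, ?_⟩
  have := Complex.abs_re_le_norm (seriesXYZ ((A0 x y z p - x) / (4 ^ n * (iter x y z p n).A))
    ((A0 x y z p - y) / (4 ^ n * (iter x y z p n).A))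
    ((A0 x y z p - z) / (4 ^ n * (iter x y z p n).A)) - 1)
  rw [Complex.sub_re, Complex.one_re] at this
  linarith [(abs_le.1 (this.trans hone)).1]

/-- A real number that approximates a number with nonnegative real part, with relative error less
than one, is nonnegative. -/
theorem isNonnegReal_of_relErrLT {u v : ℂ} (hr : r < 1) (hu : 0 ≤ u.re) (hv : v.im = 0)
    (h : RelErrLT r u v) : IsNonnegReal v := by
  refine ⟨hv, ?_⟩
  by_contra hneg
  rw [not_le] at hneg
  have h1 := Complex.re_le_norm (u - v)
  have h2 : ‖v‖ = -v.re := by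
    have e : v = (v.re : ℝ) := Complex.ext rfl (by simpa using hv)
    conv_lhs => rw [e]
    rw [Complex.norm_real, Real.norm_eq_abs, abs_of_neg hneg]
  rw [RelErrLT, h2] at h
  rw [Complex.sub_re] at h1
  nlinarith

/-- In the real cases all terms of the approximation are nonnegative, so that there is no
cancellation. -/
theorem RealCase.approxAbs_eq (hadm : Admissible x y z p) (h : RealCase x y z p) (hr : 0 < r)
    (hr' : r < 1 / 10 ^ 4) (hn : MayStop r x y z p n) {ρ : ℕ → ℂ}
    (hρ : ∀ m < n, RelErrLT r (RC 1 (1 + e x y z p m)) (ρ m)) (hρ' : ∀ m < n, (ρ m).im = 0) :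
    approxAbs x y z p ρ n = ‖approx x y z p ρ n‖ := by
  have h4 : ∀ k : ℕ, IsNonnegReal (1 / 4 ^ k : ℂ) := fun k => by
    rw [one_div]
    exact ((isNonnegReal_ofReal (r := 4) (by norm_num)).pow k).inv
  have hS := (h4 n).mul (seriesApprox_nonneg hadm h hr hr' hn)
  have hm : ∀ m ∈ Finset.range n, IsNonnegReal (1 / 4 ^ m / d x y z p m * ρ m) := fun m hm => by
    rw [Finset.mem_range] at hm
    have hr1 : r < 1 := by norm_num at hr'; linarith
    have hRC : 0 ≤ (RC 1 (1 + e x y z p m)).re := by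
      apply RC_re_nonneg
      have h1 := (hadm.iter m).norm_eNum_div_lt_one
      rw [← d_eq, ← hadm.e_eq] at h1
      have h2 := Complex.abs_re_le_norm (e x y z p m)
      have h3 := neg_abs_le (e x y z p m).re
      rw [Complex.add_re, Complex.one_re]
      linarith
    rw [div_eq_mul_inv, d_eq]
    exact ((h4 m).mul (h.iter m).dProd.inv).mul
      (isNonnegReal_of_relErrLT hr1 hRC (hρ' m hm) (hρ m hm))
  have hsum : IsNonnegReal (∑ m ∈ Finset.range n, 1 / 4 ^ m / d x y z p m * ρ m) := by
    refine Finset.sum_induction _ IsNonnegReal (fun _ _ => IsNonnegReal.add) ⟨by simp, by simp⟩ hm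
  have h6 : IsNonnegReal (6 : ℂ) := isNonnegReal_ofReal (r := 6) (by norm_num)
  rw [approxAbs, approx, (hS.add (h6.mul hsum)).norm_eq, Complex.add_re, hS.norm_eq]
  rw [show (6 : ℂ) = ((6 : ℝ) : ℂ) by norm_num, Complex.re_ofReal_mul, Complex.re_sum]
  congr 2
  exact Finset.sum_congr rfl fun m hm' => (hm m hm').norm_eq

end Stopping

end Carlson

theorem mainTheorem3 (x y z p : ℂ) (hadm : Admissible x y z p) :
    -- the integral converges, and so do all integrals that occur in the iteration
    (∀ m : ℕ,
      (iter x y z p m).p ≠ 0 ∧ d x y z p m ≠ 0 ∧ InCutPlane (1 + e x y z p m) ∧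
      IntegrableOn (rjIntegrand (iter x y z p m).x (iter x y z p m).y (iter x y z p m).z
        (iter x y z p m).p) (Ioi 0) ∧
      IntegrableOn (rcIntegrand 1 (1 + e x y z p m)) (Ioi 0)) ∧
    -- the duplication theorem
    (∀ m : ℕ,
      RJ (iter x y z p m).x (iter x y z p m).y (iter x y z p m).z (iter x y z p m).p =
        1 / 4 * RJ (iter x y z p (m + 1)).x (iter x y z p (m + 1)).y (iter x y z p (m + 1)).z
            (iter x y z p (m + 1)).p
          + 6 / d x y z p m * RC 1 (1 + e x y z p m)) ∧
    -- its iterate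
    (∀ n : ℕ,
      RJ x y z p =
        1 / 4 ^ n * RJ (iter x y z p n).x (iter x y z p n).y (iter x y z p n).z
            (iter x y z p n).p
          + 6 * ∑ m ∈ Finset.range n,
              1 / 4 ^ m / d x y z p m * RC 1 (1 + e x y z p m)) ∧
    -- the algorithm
    (∀ r : ℝ, 0 < r → r < 1 / 10 ^ 4 →
      -- it terminates
      (∀ᶠ n in atTop, MayStop r x y z p n) ∧
      ∀ n : ℕ, MayStop r x y z p n →
        -- the relative error of the series term is less than `r`
        RelErrLT r
          (RJ (iter x y z p n).x (iter x y z p n).y (iter x y z p n).z (iter x y z p n).p)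
          (seriesApprox x y z p n) ∧
        ∀ ρ : ℕ → ℂ, (∀ m < n, RelErrLT r (RC 1 (1 + e x y z p m)) (ρ m)) →
          -- the error of the result, in general
          ‖RJ x y z p - approx x y z p ρ n‖ < r * approxAbs x y z p ρ n ∧
          -- the relative error of the result, when all its terms are real
          (p.im = 0 → RealTriple x y z ∨ ConjTriple x y z → (∀ m < n, (ρ m).im = 0) →
            RelErrLT r (RJ x y z p) (approx x y z p ρ n))) := by
  refine ⟨fun m => ?_, hadm.duplication, hadm.duplication_iterate, fun r hr hr' =>
    ⟨hadm.eventually_mayStop r, fun n hn => ⟨hadm.relErrLT_seriesApprox hr hr' hn, fun ρ hρ =>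
      ⟨hadm.norm_RJ_sub_approx_lt hr hr' hn hρ, fun hp htriple hρ' => ?_⟩⟩⟩⟩
  · have h := hadm.iter m
    have hc := h.cutTriple
    have he : 1 + e x y z p m ∈ Complex.slitPlane := by rw [hadm.e_eq]; exact h.one_add_mem
    exact ⟨Complex.slitPlane_ne_zero h.p_mem, dProd_ne_zero h.p_mem, inCutPlane_iff.2 he,
      integrableOn_rjIntegrand hc.left hc.mid hc.right hc.ne h.p_mem, integrableOn_rcIntegrand he⟩
  · have hp0 : 0 < p.re := (Complex.mem_slitPlane_iff.1 hadm.p_mem).resolve_right (not_not.2 hp)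
    rw [RelErrLT, ← RealCase.approxAbs_eq hadm ⟨hp, hp0, htriple⟩ hr hr' hn hρ hρ']
    exact hadm.norm_RJ_sub_approx_lt hr hr' hn hρ
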